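/- Fix an integer $\Delta$ and a real number $c>0$. Let $\mathcal G$ be the space of isomorphism classes of connected rooted graphs $(G,o)$ with all degrees at most $\Delta$. Write $B_G(o,r)$ for the closed ball of radius $r$ around $o$ (the subgraph induced on the vertices at graph distance at most $r$ from $o$, rooted at $o$). Equip $\mathcal G$ with the distance $D((G_1,o_1),(G_2,o_2))=\frac1{1+t}$, where $t=\sup\{s: B_{G_1}(o_1,s)\cong B_{G_2}(o_2,s)\}\in[0,\infty]$, and with its Borel $\sigma$-algebra. For a finite graph $G=(V,E)$ let $$h(G)=\min\Big\{\frac{|E(A,V\setminus A)|}{|A|} : A\subseteq V,\ 0<|A|\le |V|/2\Big\}$$ be its Cheeger constant, where $E(A,B)$ is the set of edges with one endpoint in $A$ and the other in $B$ (and $h(G)=\infty$ if $|V|=1$). For a graph $G$ let $$p_c(G)=\inf\{p\in[0,1] : \mathbb P_p(\text{there is an infinite open component})>0\},$$ where $\mathbb P_p$ is Bernoulli bond percolation on $G$ with parameter $p$. Theorem. Let $(G_n)_{n\ge 1}$ be a sequence of finite nonempty graphs with $h(G_n)\ge c$ and all degrees at most $\Delta$, and let $U_n$ be a uniformly random vertex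 of $G_n$. Let $(G,\rho)$ be a random rooted graph whose law $\mu$ is a Borel probability measure on $\mathcal G$, and suppose that $G$ is almost surely infinite. Suppose that $G_n$ converges locally weakly to $(G,\rho)$, that is, for every integer $R>0$ and every finite connected rooted graph $(H,\rho')$, $$\mathbb P\big((B_{G_n}(U_n,R),U_n)\cong(H,\rho')\big)\longrightarrow \mathbb P\big((B_G(\rho,R),\rho)\cong(H,\rho')\big)\qquad(n\to\infty).$$ Then: 1. $p_c(G)$ is almost surely constant: there is $p_0\in\mathbb R$ with $p_c(G)=p_0$ almost surely. 2. More generally, for every Borel measurable function $f:\mathcal G\to\mathbb R$ that is invariant under changes of the root (that is, $f((\tau,v))=f((\tau,v'))$ for every connected graph $\tau$ with degrees at most $\Delta$ and all vertices $v,v'$ of $\tau$), there is $a\in\mathbb R$ with $f((G,\rho))=a$ almost surely. -/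

import Mathlib

open MeasureTheory Filter Topology
open scoped ENNReal

/-! ## Rooted graphs and balls -/

/-- The rooted graphs `(G, o)` and `(H, p)` are isomorphic: some graph isomorphism of `G` onto `H`
takes `o` to `p`. -/
def RootedIso {V W : Type*} (G : SimpleGraph V) (o : V) (H : SimpleGraph W) (p : W) : Prop :=
  ∃ e : G ≃g H, e o = p

theorem RootedIso.refl {V : Type*} (G : SimpleGraph V) (o : V) : RootedIso G o G o :=
  ⟨SimpleGraph.Iso.refl, rfl⟩

theorem RootedIso.symm {V W : Type*} {G : SimpleGraph V} {o : V} {H : SimpleGraph W} {p : W}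
    (h : RootedIso G o H p) : RootedIso H p G o := by
  obtain ⟨e, rfl⟩ := h
  exact ⟨e.symm, e.symm_apply_apply o⟩

theorem RootedIso.trans {V W Z : Type*} {G : SimpleGraph V} {o : V} {H : SimpleGraph W} {p : W}
    {K : SimpleGraph Z} {q : Z} (h : RootedIso G o H p) (h' : RootedIso H p K q) :
    RootedIso G o K q := by
  obtain ⟨e, rfl⟩ := h
  obtain ⟨e', rfl⟩ := h'
  exact ⟨e.trans e', rfl⟩

/-- The vertices at graph distance at most `r` from `o`. -/
def ballSet {V : Type*} (G : SimpleGraph V) (o : V) (r : ℕ) : Set V := {v | G.edist o v ≤ r}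

/-- The centre `o`, as a vertex of the ball of radius `r` around it. -/
def ballRoot {V : Type*} (G : SimpleGraph V) (o : V) (r : ℕ) : ballSet G o r :=
  ⟨o, by simp [ballSet]⟩

/-- The closed ball `B_G(o, r)`: the subgraph of `G` induced on the vertices at distance at most
`r` from `o`. It is rooted at `ballRoot G o r`. -/
def ballGraph {V : Type*} (G : SimpleGraph V) (o : V) (r : ℕ) : SimpleGraph (ballSet G o r) :=
  G.induce (ballSet G o r)

/-- The balls of radius `r` around `o` in `G` and around `p` in `H` are isomorphic as rooted
graphs. -/
def BallIso {V W : Type*} (G : SimpleGraph V) (o : V) (H : SimpleGraph W) (p : W) (r : ℕ) : Prop :=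
  RootedIso (ballGraph G o r) (ballRoot G o r) (ballGraph H p r) (ballRoot H p r)

theorem edist_map_le {V W : Type*} {G : SimpleGraph V} {H : SimpleGraph W} (f : G →g H) (u v : V) :
    H.edist (f u) (f v) ≤ G.edist u v := by
  by_cases h : G.edist u v = ⊤
  · simp [h]
  · obtain ⟨w, hw⟩ := SimpleGraph.exists_walk_of_edist_ne_top h
    rw [← hw, ← SimpleGraph.Walk.length_map f w]
    exact SimpleGraph.edist_le _

theorem edist_iso {V W : Type*} {G : SimpleGraph V} {H : SimpleGraph W} (e : G ≃g H) (u v : V) :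
    H.edist (e u) (e v) = G.edist u v := by
  refine le_antisymm (edist_map_le e.toHom u v) ?_
  simpa using edist_map_le e.symm.toHom (e u) (e v)

theorem exists_walk_ballGraph {V : Type*} {G : SimpleGraph V} {o : V} {r : ℕ} {u v : V}
    (w : G.Walk u v) : ∀ (_ : G.edist o u + w.length ≤ r) (hu : u ∈ ballSet G o r),
    ∃ hv : v ∈ ballSet G o r, ∃ w' : (ballGraph G o r).Walk ⟨u, hu⟩ ⟨v, hv⟩,
      w'.length = w.length := by
  induction w with
  | nil => intro _ hu; exact ⟨hu, .nil, rfl⟩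
  | @cons a b c hab w ih =>
    intro h hu
    have h1 : G.edist a b ≤ 1 := by
      simpa using SimpleGraph.edist_le (SimpleGraph.Walk.cons hab .nil)
    have h2 : G.edist o b + w.length ≤ r := by
      refine le_trans ?_ h
      calc G.edist o b + w.length ≤ (G.edist o a + 1) + w.length := by
            gcongr
            exact SimpleGraph.edist_triangle.trans (by gcongr)
        _ = _ := by
            rw [SimpleGraph.Walk.length_cons]; push_cast; ring
    have hb : b ∈ ballSet G o r := le_trans le_self_add h2
    obtain ⟨hv, w', hw'⟩ := ih h2 hb
    have hadj : (ballGraph G o r).Adj ⟨a, hu⟩ ⟨b, hb⟩ := hab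
    exact ⟨hv, .cons hadj w', by simp [hw']⟩

/-- Distances from the centre are the same in the ball as in the whole graph. -/
theorem edist_ballGraph {V : Type*} (G : SimpleGraph V) (o : V) (r : ℕ) (v : ballSet G o r) :
    (ballGraph G o r).edist (ballRoot G o r) v = G.edist o v := by
  refine le_antisymm ?_ (edist_map_le (SimpleGraph.Embedding.induce _).toHom _ _)
  have hv : G.edist o v ≤ r := v.2
  have hne : G.edist o v ≠ ⊤ := ne_top_of_le_ne_top (ENat.natCast_ne_top r) hv
  obtain ⟨w, hw⟩ := SimpleGraph.exists_walk_of_edist_ne_top hne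
  obtain ⟨hv', w', hw'⟩ := exists_walk_ballGraph (o := o) (r := r) w
    (by rw [hw]; simpa using hv) (ballRoot G o r).2
  rw [← hw, ← hw']
  exact SimpleGraph.edist_le w'

theorem RootedIso.ballIso {V W : Type*} {G : SimpleGraph V} {o : V} {H : SimpleGraph W} {p : W}
    (h : RootedIso G o H p) (r : ℕ) : BallIso G o H p r := by
  obtain ⟨e, rfl⟩ := h
  have key (v : V) : v ∈ ballSet G o r ↔ e v ∈ ballSet H (e o) r := by
    simp [ballSet, edist_iso]
  exact ⟨⟨e.toEquiv.subtypeEquiv key, fun {_ _} ↦ e.map_rel_iff⟩, rfl⟩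

theorem BallIso.mono {V W : Type*} {G : SimpleGraph V} {o : V} {H : SimpleGraph W} {p : W}
    {r s : ℕ} (hrs : r ≤ s) (h : BallIso G o H p s) : BallIso G o H p r := by
  obtain ⟨e, he⟩ := h
  have hd (v : ballSet G o s) : H.edist p (e v) = G.edist o v := by
    rw [← edist_ballGraph, ← edist_ballGraph, ← he, edist_iso]
  have hd' (v : ballSet H p s) : G.edist o (e.symm v) = H.edist p v := by
    rw [← hd, e.apply_symm_apply]
  have hsG : ∀ v ∈ ballSet G o r, v ∈ ballSet G o s := fun v hv ↦
    le_trans (b := (r : ℕ∞)) hv (by exact_mod_cast hrs)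
  have hsH : ∀ v ∈ ballSet H p r, v ∈ ballSet H p s := fun v hv ↦
    le_trans (b := (r : ℕ∞)) hv (by exact_mod_cast hrs)
  refine ⟨⟨⟨fun v ↦ ⟨e ⟨v, hsG v v.2⟩, (hd _).trans_le v.2⟩,
    fun v ↦ ⟨e.symm ⟨v, hsH v v.2⟩, (hd' _).trans_le v.2⟩,
    fun v ↦ Subtype.ext (by simp), fun v ↦ Subtype.ext (by simp)⟩, ?_⟩, ?_⟩
  · intro a b
    exact e.map_rel_iff (a := ⟨a, hsG a a.2⟩) (b := ⟨b, hsG b b.2⟩)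
  · refine Subtype.ext ?_
    change ((e (ballRoot G o s) : ballSet H p s) : W) = p
    rw [he]
    rfl

/-! ## The space of rooted connected graphs with degrees at most `Δ` -/

/-- A connected rooted graph all of whose degrees are at most `Δ`. Such a graph is countable, so
vertex sets in `Type` represent all of them up to isomorphism. -/
structure RootedGraph (Δ : ℕ) where
  /-- the set of vertices -/
  V : Type
  /-- the graph -/
  graph : SimpleGraph V
  /-- the root -/
  root : V
  connected : graph.Connected
  degree_le : ∀ v, (graph.neighborSet v).encard ≤ Δ

/-- The same graph with its root moved to `v`. -/
def RootedGraph.reroot {Δ : ℕ} (X : RootedGraph Δ) (v : X.V) : RootedGraph Δ :=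
  { X with root := v }

/-- Isomorphism of rooted graphs. -/
instance RootedGraph.instSetoid (Δ : ℕ) : Setoid (RootedGraph Δ) where
  r X Y := RootedIso X.graph X.root Y.graph Y.root
  iseqv := ⟨fun _ ↦ RootedIso.refl _ _, RootedIso.symm, RootedIso.trans⟩

/-- The space `𝒢` of isomorphism classes of connected rooted graphs with degrees at most `Δ`. -/
def RootedGraphSpace (Δ : ℕ) : Type 1 := Quotient (RootedGraph.instSetoid Δ)

/-- The isomorphism class of a rooted graph. -/
def RootedGraph.toSpace {Δ : ℕ} (X : RootedGraph Δ) : RootedGraphSpace Δ := Quotient.mk _ X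

/-- The radius of agreement of two rooted graphs: the supremum of all `s` such that the balls of
radius `s` around the roots are isomorphic (possibly infinite). -/
noncomputable def RootedGraph.agreement {Δ : ℕ} (X Y : RootedGraph Δ) : ℕ∞ :=
  ⨆ (s : ℕ) (_ : BallIso X.graph X.root Y.graph Y.root s), (s : ℕ∞)

theorem RootedGraph.agreement_self {Δ : ℕ} (X : RootedGraph Δ) : X.agreement X = ⊤ := by
  refine ENat.eq_top_iff_forall_ge.2 fun m ↦ ?_
  exact le_iSup₂_of_le m ((RootedIso.refl _ _).ballIso m) le_rfl

theorem RootedGraph.agreement_comm {Δ : ℕ} (X Y : RootedGraph Δ) :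
    X.agreement Y = Y.agreement X :=
  iSup_congr fun _ ↦ iSup_congr_Prop ⟨RootedIso.symm, RootedIso.symm⟩ fun _ ↦ rfl

theorem RootedGraph.min_agreement_le {Δ : ℕ} (X Y Z : RootedGraph Δ) :
    min (X.agreement Y) (Y.agreement Z) ≤ X.agreement Z := by
  refine le_of_forall_lt fun m hm ↦ ?_
  obtain ⟨h1, h2⟩ := lt_min_iff.1 hm
  simp only [agreement, lt_iSup_iff] at h1 h2 ⊢
  obtain ⟨s, hs, hms⟩ := h1
  obtain ⟨t, ht, hmt⟩ := h2
  rcases le_total s t with h | h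
  · exact ⟨s, RootedIso.trans hs (ht.mono h), hms⟩
  · exact ⟨t, RootedIso.trans (hs.mono h) ht, hmt⟩

theorem RootedGraph.agreement_congr {Δ : ℕ} (X Y X' Y' : RootedGraph Δ)
    (hX : X ≈ X') (hY : Y ≈ Y') : X.agreement Y = X'.agreement Y' := by
  refine iSup_congr fun s ↦ iSup_congr_Prop ⟨fun h ↦ ?_, fun h ↦ ?_⟩ fun _ ↦ rfl
  · exact (RootedIso.ballIso (RootedIso.symm hX) s).trans (h.trans (RootedIso.ballIso hY s))
  · exact (RootedIso.ballIso hX s).trans (h.trans (RootedIso.ballIso (RootedIso.symm hY) s))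

namespace RootedGraphSpace

/-- The radius of agreement `t = sup {s : B_{G₁}(o₁, s) ≅ B_{G₂}(o₂, s)}`. -/
noncomputable def agreement {Δ : ℕ} (x y : RootedGraphSpace Δ) : ℕ∞ :=
  Quotient.liftOn₂ x y RootedGraph.agreement RootedGraph.agreement_congr

/-- The distance `D = 1 / (1 + t)`, with value `0` for `t = ∞`. -/
noncomputable instance instPseudoMetricSpace (Δ : ℕ) : PseudoMetricSpace (RootedGraphSpace Δ) where
  dist x y := ((1 + (agreement x y : ℝ≥0∞))⁻¹).toReal
  dist_self x := by
    induction x using Quotient.inductionOn with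
    | h X =>
      have h : agreement (⟦X⟧ : RootedGraphSpace Δ) (⟦X⟧ : RootedGraphSpace Δ) = ⊤ :=
        X.agreement_self
      simp [h]
  dist_comm x y := by
    induction x, y using Quotient.inductionOn₂ with
    | h X Y =>
      have h : agreement (⟦X⟧ : RootedGraphSpace Δ) (⟦Y⟧ : RootedGraphSpace Δ) =
        agreement (⟦Y⟧ : RootedGraphSpace Δ) (⟦X⟧ : RootedGraphSpace Δ) := X.agreement_comm Y
      simp [h]
  dist_triangle x y z := by
    induction x, y, z using Quotient.inductionOn₃ with
    | h X Y Z =>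
      have h : min (agreement (⟦X⟧ : RootedGraphSpace Δ) (⟦Y⟧ : RootedGraphSpace Δ))
          (agreement (⟦Y⟧ : RootedGraphSpace Δ) (⟦Z⟧ : RootedGraphSpace Δ)) ≤
        agreement (⟦X⟧ : RootedGraphSpace Δ) (⟦Z⟧ : RootedGraphSpace Δ) :=
        X.min_agreement_le Y Z
      have fin (t : ℕ∞) : (1 + (t : ℝ≥0∞))⁻¹ ≠ ∞ := by simp
      have anti {s t : ℕ∞} (hst : s ≤ t) :
          ((1 + (t : ℝ≥0∞))⁻¹).toReal ≤ ((1 + (s : ℝ≥0∞))⁻¹).toReal := by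
        refine ENNReal.toReal_mono (fin s) (ENNReal.inv_le_inv.2 ?_)
        gcongr
      rcases min_le_iff.1 h with h | h
      · exact (anti h).trans (le_add_of_nonneg_right ENNReal.toReal_nonneg)
      · exact (anti h).trans (le_add_of_nonneg_left ENNReal.toReal_nonneg)

/-- The Borel `σ`-algebra of `𝒢`. -/
noncomputable instance instMeasurableSpace (Δ : ℕ) : MeasurableSpace (RootedGraphSpace Δ) :=
  borel (RootedGraphSpace Δ)

instance instBorelSpace (Δ : ℕ) : BorelSpace (RootedGraphSpace Δ) := ⟨rfl⟩

/-- The graph is infinite. -/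
def IsInfinite {Δ : ℕ} (x : RootedGraphSpace Δ) : Prop :=
  Quotient.liftOn x (fun X ↦ Infinite X.V) fun X Y h ↦ by
    obtain ⟨e, -⟩ : RootedIso X.graph X.root Y.graph Y.root := h
    exact propext e.toEquiv.infinite_iff

/-- The ball of radius `R` around the root is isomorphic to the rooted graph `(H, p)`. -/
def HasBall {Δ : ℕ} {W : Type} (H : SimpleGraph W) (p : W) (R : ℕ) (x : RootedGraphSpace Δ) :
    Prop :=
  Quotient.liftOn x
    (fun X ↦ RootedIso (ballGraph X.graph X.root R) (ballRoot X.graph X.root R) H p)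
    fun _ _ h ↦ propext
      ⟨fun k ↦ (RootedIso.ballIso (RootedIso.symm h) R).trans k,
        fun k ↦ (RootedIso.ballIso h R).trans k⟩

/-- The function `f` does not depend on the position of the root. -/
def RootInvariant {Δ : ℕ} (f : RootedGraphSpace Δ → ℝ) : Prop :=
  ∀ (X : RootedGraph Δ) (v w : X.V), f (X.reroot v).toSpace = f (X.reroot w).toSpace

end RootedGraphSpace

/-! ## Bernoulli bond percolation -/

/-- The graph of open edges, where `ω` is the set of open edges. -/
def openGraph {V : Type*} (G : SimpleGraph V) (ω : Set (Sym2 V)) : SimpleGraph V :=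
  SimpleGraph.fromEdgeSet (G.edgeSet ∩ ω)

/-- The event that there is an infinite open component. -/
def percolates {V : Type*} (G : SimpleGraph V) : Set (Set (Sym2 V)) :=
  {ω | ∃ C : (openGraph G ω).ConnectedComponent, C.supp.Infinite}

/-- The critical probability `p_c(G) = inf {p ∈ [0, 1] : ℙ_p(∃ an infinite open component) > 0}`,
where under `ℙ_p` each edge of `G` is open with probability `p`, independently. The infimum is taken
in `[0, 1]`, so it is `1` if the set is empty. -/
noncomputable def criticalProb {V : Type*} (G : SimpleGraph V) : ℝ :=
  (sInf {p : unitInterval | 0 < ProbabilityTheory.setBernoulli G.edgeSet p (percolates G)} :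
    unitInterval)

theorem setBernoulli_equiv {α β : Type*} (e : α ≃ β) (u : Set α) (v : Set β)
    (huv : ∀ a, a ∈ u ↔ e a ∈ v) (p : unitInterval) (S : Set (Set β)) :
    ProbabilityTheory.setBernoulli v p S =
      ProbabilityTheory.setBernoulli u p ((fun s ↦ e '' s) ⁻¹' S) := by
  rw [ProbabilityTheory.setBernoulli_apply', ProbabilityTheory.setBernoulli_apply',
    ← Measure.infinitePi_map_piCongrLeft _ e, MeasurableEquiv.map_apply]
  simp only [← huv]
  congr 1
  ext f
  simp only [Set.mem_preimage]
  have : {b | MeasurableEquiv.piCongrLeft (fun _ : β ↦ Prop) e f b} = e '' {a | f a} := by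
    ext b
    obtain ⟨a, rfl⟩ := e.surjective b
    have h : MeasurableEquiv.piCongrLeft (fun _ : β ↦ Prop) e f (e a) = f a := by
      rw [MeasurableEquiv.coe_piCongrLeft]
      exact Equiv.piCongrLeft_apply_apply (fun _ : β ↦ Prop) e f a
    simp [h]
  rw [← this]

/-- The bijection of unordered pairs induced by a bijection. -/
def sym2Equiv {V W : Type*} (e : V ≃ W) : Sym2 V ≃ Sym2 W where
  toFun := Sym2.map e
  invFun := Sym2.map e.symm
  left_inv z := by simp [Sym2.map_map]
  right_inv z := by simp [Sym2.map_map]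

theorem percolates_image {V W : Type*} {G : SimpleGraph V} {H : SimpleGraph W} (e : G ≃g H)
    (ω : Set (Sym2 V)) (h : ω ∈ percolates G) :
    sym2Equiv e.toEquiv '' ω ∈ percolates H := by
  obtain ⟨C, hC⟩ := h
  let f : openGraph G ω →g openGraph H (sym2Equiv e.toEquiv '' ω) :=
    { toFun := e
      map_rel' := by
        intro a b hab
        simp only [openGraph, SimpleGraph.fromEdgeSet_adj, Set.mem_inter_iff,
          SimpleGraph.mem_edgeSet] at hab ⊢
        exact ⟨⟨e.map_rel_iff.2 hab.1.1, s(a, b), hab.1.2, rfl⟩, e.injective.ne hab.2⟩ }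
  refine ⟨C.map f, (hC.image e.injective.injOn).mono ?_⟩
  rintro _ ⟨v, rfl, rfl⟩
  rfl

theorem criticalProb_congr {V W : Type*} {G : SimpleGraph V} {H : SimpleGraph W} (e : G ≃g H) :
    criticalProb G = criticalProb H := by
  have key (p : unitInterval) : ProbabilityTheory.setBernoulli H.edgeSet p (percolates H) =
      ProbabilityTheory.setBernoulli G.edgeSet p (percolates G) := by
    rw [setBernoulli_equiv (sym2Equiv e.toEquiv) G.edgeSet H.edgeSet]
    · congr 1
      ext ω
      refine ⟨fun h ↦ ?_, percolates_image e ω⟩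
      have h' := percolates_image e.symm _ h
      rw [Set.image_image] at h'
      have : (fun x ↦ sym2Equiv e.symm.toEquiv (sym2Equiv e.toEquiv x)) = id := by
        funext x
        induction x using Sym2.ind with
        | h a b => simp [sym2Equiv]
      rwa [this, Set.image_id] at h'
    · intro x
      induction x using Sym2.ind with
      | h a b => exact e.map_rel_iff.symm
  simp only [criticalProb, key]

/-- The critical probability of an isomorphism class of rooted graphs. -/
noncomputable def RootedGraphSpace.criticalProb {Δ : ℕ} (x : RootedGraphSpace Δ) : ℝ :=
  Quotient.liftOn x (fun X ↦ _root_.criticalProb X.graph) fun X Y h ↦ by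
    obtain ⟨e, -⟩ : RootedIso X.graph X.root Y.graph Y.root := h
    exact criticalProb_congr e

/-! ## Cheeger constant and local weak convergence -/

/-- The set `E(A, B)` of edges with one endpoint in `A` and the other in `B`. -/
def edgesBetween {V : Type*} (G : SimpleGraph V) (A B : Set V) : Set (Sym2 V) :=
  {e ∈ G.edgeSet | ∃ a ∈ A, ∃ b ∈ B, e = s(a, b)}

/-- The Cheeger constant `h(G) = min {|E(A, V \ A)| / |A| : A ⊆ V, 0 < |A| ≤ |V| / 2}` of a finite
graph (it is `∞` for a graph with one vertex, where there are no such `A`). -/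
noncomputable def cheegerConstant {V : Type*} [Fintype V] (G : SimpleGraph V) : ℝ≥0∞ :=
  ⨅ (A : Finset V) (_ : 0 < A.card ∧ 2 * A.card ≤ Fintype.card V),
    ((edgesBetween G (A : Set V) (A : Set V)ᶜ).ncard : ℝ≥0∞) / (A.card : ℝ≥0∞)

/-- The probability that the ball of radius `R` around a uniformly chosen random vertex of the
finite graph `G` is isomorphic to the rooted graph `(H, p)`. -/
noncomputable def uniformBallProb {V : Type*} [Fintype V] (G : SimpleGraph V) (R : ℕ) {W : Type}
    (H : SimpleGraph W) (p : W) : ℝ :=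
  (({u : V | RootedIso (ballGraph G u R) (ballRoot G u R) H p}.ncard : ℕ) : ℝ) /
    (Fintype.card V : ℝ)

/-- The finite graphs `G n` converge locally weakly to the random rooted graph with law `μ`: for
every `R > 0` and every finite (connected) rooted graph `(H, p)`, the probability that the ball of
radius `R` around a uniform random vertex of `G n` is isomorphic to `(H, p)` tends to the
`μ`-probability that the ball of radius `R` around the root is isomorphic to `(H, p)`. -/
def ConvergesLocallyWeakly {Δ : ℕ} {V : ℕ → Type*} [∀ n, Fintype (V n)]
    (G : ∀ n, SimpleGraph (V n)) (μ : Measure (RootedGraphSpace Δ)) : Prop :=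
  ∀ R : ℕ, 0 < R → ∀ (W : Type) [Finite W] (H : SimpleGraph W) (p : W), H.Connected →
    Tendsto (fun n ↦ uniformBallProb (G n) R H p) atTop
      (𝓝 (μ.real {x | RootedGraphSpace.HasBall H p R x}))

/-! Everything reduces to a zero-one law: a measurable set `A` of rooted graphs that does not depend
on the root has `μ`-probability 0 or 1. An invariant `f` then has all its level events trivial, so
it is almost surely constant.

Local weak convergence speaks only of events determined by a ball of fixed radius, and such an `A`
is usually not one of them. It is approximated: outer regularity gives an open `U ⊇ A` with `μ (U \
A) < ε`, and `U` is an increasing union of local events, so some local `E ⊆ U` has `μ (U \ E) ≤ ε`.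
In `G n` the roots whose rooted graph lies in `E` form a vertex set, and expansion bounds `c * min
(P E) (1 - P E)` by `Δ` times the probability that the root is in `E` with a neighbour outside `E`.
Both events are local, so the bound passes to `μ` (`mul_min_measureReal_le`).

Under `μ` this boundary event is rare. If the root is in `E` but not in `A`, it is in `U \ A`. If it
is in `A`, the exceptional neighbour is also in `A ⊆ U` by invariance, hence in `U \ E`; by mass
transport (`measureReal_hasNeighborIn_le`) having such a neighbour has probability at most `Δ * ε`.
Letting `ε → 0` gives `min (μ A) (1 - μ A) = 0`.

For `p_c`, the zero-one law is applied to the probability of percolation at each `p` in a countable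
dense set. These functions are measurable, being built from arm probabilities that depend on finite
balls, and by monotonicity in `p` their values determine `p_c`. -/

namespace RootedGraphSpace

/-! ### Local events and the topology of the space -/

/-- Two rooted graphs are equivalent when the balls of radius `r` around their roots are
isomorphic. -/
def ballSetoid (Δ r : ℕ) : Setoid (RootedGraphSpace Δ) where
  r x y := Quotient.liftOn₂ x y (fun X Y ↦ BallIso X.graph X.root Y.graph Y.root r)
    fun _ _ _ _ hX hY ↦ propext
      ⟨fun h ↦ (RootedIso.ballIso (RootedIso.symm hX) r).trans (h.trans (RootedIso.ballIso hY r)),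
        fun h ↦ (RootedIso.ballIso hX r).trans
          (h.trans (RootedIso.ballIso (RootedIso.symm hY) r))⟩
  iseqv :=
    { refl := by
        rintro ⟨X⟩
        exact (RootedIso.refl X.graph X.root).ballIso r
      symm := by
        rintro ⟨X⟩ ⟨Y⟩ h
        exact RootedIso.symm h
      trans := by
        rintro ⟨X⟩ ⟨Y⟩ ⟨Z⟩ h h'
        exact RootedIso.trans h h' }

theorem ballSetoid_toSpace {Δ r : ℕ} {X Y : RootedGraph Δ} :
    ballSetoid Δ r X.toSpace Y.toSpace ↔ BallIso X.graph X.root Y.graph Y.root r := Iff.rfl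

theorem ballSetoid_mono {Δ r s : ℕ} (hrs : r ≤ s) {x y : RootedGraphSpace Δ}
    (h : ballSetoid Δ s x y) : ballSetoid Δ r x y := by
  induction x, y using Quotient.inductionOn₂ with
  | h X Y => exact BallIso.mono hrs h

/-- The set `E` is determined by the ball of radius `r` around the root. -/
def IsLocal {Δ : ℕ} (r : ℕ) (E : Set (RootedGraphSpace Δ)) : Prop :=
  ∀ ⦃x y⦄, ballSetoid Δ r x y → x ∈ E → y ∈ E

namespace IsLocal
variable {Δ r s : ℕ} {E F : Set (RootedGraphSpace Δ)}

theorem mono (hrs : r ≤ s) (h : IsLocal r E) : IsLocal s E :=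
  fun _ _ hxy hx ↦ h (ballSetoid_mono hrs hxy) hx

theorem compl (h : IsLocal r E) : IsLocal r Eᶜ :=
  fun _ _ hxy hx hy ↦ hx (h ((ballSetoid Δ r).symm hxy) hy)

theorem inter (h : IsLocal r E) (h' : IsLocal r F) : IsLocal r (E ∩ F) :=
  fun _ _ hxy hx ↦ ⟨h hxy hx.1, h' hxy hx.2⟩

/-- Distance below `1 / (1 + r)` forces agreement beyond radius `r`. Complements of local events are
local, so local events are in fact clopen. -/
theorem isOpen (h : IsLocal r E) : IsOpen E := by
  refine Metric.isOpen_iff.2 fun x hx ↦ ⟨((1 + (r : ℝ≥0∞))⁻¹).toReal, ?_, ?_⟩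
  · exact ENNReal.toReal_pos (by simp) (by simp)
  · intro y hy
    rw [Metric.mem_ball, dist_comm] at hy
    induction x, y using Quotient.inductionOn₂ with
    | h X Y =>
      have hy' : ((1 + ((X.agreement Y : ℕ∞) : ℝ≥0∞))⁻¹).toReal < ((1 + (r : ℝ≥0∞))⁻¹).toReal := hy
      rw [ENNReal.toReal_lt_toReal (by simp) (by simp), ENNReal.inv_lt_inv,
        ENNReal.add_lt_add_iff_left (by simp)] at hy'
      have hlt : (r : ℕ∞) < X.agreement Y := by
        rw [← ENat.toENNReal_lt]
        simpa using hy'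
      simp only [RootedGraph.agreement, lt_iSup_iff] at hlt
      obtain ⟨s, hs, hrs⟩ := hlt
      exact h (ballSetoid_toSpace.2 (hs.mono (by exact_mod_cast hrs.le))) hx

theorem measurableSet (h : IsLocal r E) : MeasurableSet E := h.isOpen.measurableSet

end IsLocal

/-- The largest subset of `U` that is determined by the ball of radius `r` around the root. -/
def localCore {Δ : ℕ} (r : ℕ) (U : Set (RootedGraphSpace Δ)) : Set (RootedGraphSpace Δ) :=
  {x | ∀ y, ballSetoid Δ r x y → y ∈ U}

section localCore
variable {Δ : ℕ} (U : Set (RootedGraphSpace Δ))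

theorem isLocal_localCore (r : ℕ) : IsLocal r (localCore r U) :=
  fun _ _ hxy hx _ hz ↦ hx _ ((ballSetoid Δ r).trans hxy hz)

theorem localCore_subset (r : ℕ) : localCore r U ⊆ U := fun x hx ↦ hx x ((ballSetoid Δ r).refl x)

theorem monotone_localCore : Monotone fun r ↦ localCore r U :=
  fun _ _ hrs _ hx _ hy ↦ hx _ (ballSetoid_mono hrs hy)

/-- Agreement up to radius `r` puts two points within `1 / (1 + r)`, so a point of an open set lies
in it with its whole class once `r` is large. This exhausts open sets by events that local weak
convergence can see. -/
theorem iUnion_localCore {U : Set (RootedGraphSpace Δ)} (hU : IsOpen U) :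
    ⋃ r, localCore r U = U := by
  refine Set.Subset.antisymm (Set.iUnion_subset fun r ↦ localCore_subset U r) fun x hx ↦ ?_
  obtain ⟨ε, hε, hball⟩ := Metric.isOpen_iff.1 hU x hx
  obtain ⟨r, hr⟩ := exists_nat_one_div_lt hε
  refine Set.mem_iUnion.2 ⟨r, fun y hy ↦ hball ?_⟩
  rw [Metric.mem_ball, dist_comm]
  refine lt_of_le_of_lt ?_ hr
  induction x, y using Quotient.inductionOn₂ with
  | h X Y =>
    have h : (r : ℕ∞) ≤ X.agreement Y := le_iSup₂_of_le r (ballSetoid_toSpace.1 hy) le_rfl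
    have h' : (r : ℝ≥0∞) ≤ ((X.agreement Y : ℕ∞) : ℝ≥0∞) := by
      rw [← ENat.toENNReal_coe]; exact_mod_cast h
    change ((1 + ((X.agreement Y : ℕ∞) : ℝ≥0∞))⁻¹).toReal ≤ _
    have : (1 : ℝ) / (r + 1) = ((1 + (r : ℝ≥0∞))⁻¹).toReal := by
      rw [ENNReal.toReal_inv, ENNReal.toReal_add (by simp) (by simp)]
      simp [add_comm]
    rw [this]
    refine ENNReal.toReal_mono (by simp) (ENNReal.inv_le_inv.2 ?_)
    gcongr

end localCore

end RootedGraphSpace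

/-! ### Moving the root to a neighbour -/

theorem mem_ballSet_self {V : Type*} (G : SimpleGraph V) (o : V) (r : ℕ) : o ∈ ballSet G o r :=
  (ballRoot G o r).2

theorem edist_le_one_of_adj {V : Type*} {G : SimpleGraph V} {u v : V} (h : G.Adj u v) :
    G.edist u v ≤ 1 := by
  simpa using SimpleGraph.edist_le (SimpleGraph.Walk.cons h .nil)

/-- A ball of radius `r` around a neighbour of the centre of a ball of radius `r + 1` does not
change when the whole graph is replaced by the larger ball. -/
theorem ballGraph_neighbor {V : Type*} {G : SimpleGraph V} {o v : V} {r : ℕ} (hov : G.Adj o v)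
    (hv : v ∈ ballSet G o (r + 1)) :
    BallIso (ballGraph G o (r + 1)) ⟨v, hv⟩ G v r := by
  have h1 : G.edist o v ≤ 1 := edist_le_one_of_adj hov
  have hsub : ∀ w ∈ ballSet G v r, ∃ hw : w ∈ ballSet G o (r + 1),
      (⟨w, hw⟩ : ballSet G o (r + 1)) ∈ ballSet (ballGraph G o (r + 1)) ⟨v, hv⟩ r := by
    intro w hw
    have hw' : G.edist v w ≤ r := hw
    obtain ⟨p, hp⟩ := SimpleGraph.exists_walk_of_edist_ne_top
      (ne_top_of_le_ne_top (ENat.natCast_ne_top r) hw')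
    obtain ⟨hw2, q, hq⟩ := exists_walk_ballGraph (o := o) (r := r + 1) p (by
      rw [hp]
      calc G.edist o v + G.edist v w ≤ 1 + r := add_le_add h1 hw'
        _ = _ := by push_cast; ring) hv
    refine ⟨hw2, (SimpleGraph.edist_le q).trans ?_⟩
    rw [hq, hp]
    exact hw'
  have hsub' : ∀ w : ballSet G o (r + 1), w ∈ ballSet (ballGraph G o (r + 1)) ⟨v, hv⟩ r →
      (w : V) ∈ ballSet G v r := fun w hw ↦
    (edist_map_le (SimpleGraph.Embedding.induce (ballSet G o (r + 1))).toHom ⟨v, hv⟩ w).trans hw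
  refine ⟨⟨⟨fun w ↦ ⟨w.1.1, hsub' _ w.2⟩, fun w ↦ ⟨⟨w.1, (hsub _ w.2).1⟩, (hsub _ w.2).2⟩,
    fun _ ↦ rfl, fun _ ↦ rfl⟩, Iff.rfl⟩, rfl⟩

/-- An isomorphism of the larger balls carries neighbours of the centre to neighbours, and the
`r`-ball around a neighbour lies inside the `(r + 1)`-ball: moving the root costs one unit of
radius. -/
theorem BallIso.exists_neighbor {V W : Type*} {G : SimpleGraph V} {o : V} {H : SimpleGraph W}
    {p : W} {r : ℕ} (h : BallIso G o H p (r + 1)) {v : V} (hov : G.Adj o v) :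
    ∃ w, H.Adj p w ∧ BallIso G v H w r := by
  obtain ⟨e, he⟩ := h
  have hv : v ∈ ballSet G o (r + 1) :=
    (edist_le_one_of_adj hov).trans (by push_cast; exact le_add_self)
  have hadj : H.Adj p (e ⟨v, hv⟩).1 := by
    have : (ballGraph H p (r + 1)).Adj (e (ballRoot G o (r + 1))) (e ⟨v, hv⟩) :=
      e.map_rel_iff.2 hov
    rw [he] at this
    exact this
  refine ⟨_, hadj, ?_⟩
  exact (RootedIso.symm (ballGraph_neighbor hov hv)).trans
    ((RootedIso.ballIso ⟨e, rfl⟩ r).trans (ballGraph_neighbor hadj (e ⟨v, hv⟩).2))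

namespace RootedGraphSpace

/-- The rooted graphs for which moving the root to a suitable neighbour gives an element of `E`. -/
def hasNeighborIn {Δ : ℕ} (E : Set (RootedGraphSpace Δ)) : Set (RootedGraphSpace Δ) :=
  {x | ∃ (X : RootedGraph Δ) (v : X.V), X.toSpace = x ∧ X.graph.Adj X.root v ∧
    (X.reroot v).toSpace ∈ E}

/-- The representative is immaterial, because an isomorphism transports the chosen neighbour. -/
theorem toSpace_mem_hasNeighborIn {Δ : ℕ} {E : Set (RootedGraphSpace Δ)} {X : RootedGraph Δ} :
    X.toSpace ∈ hasNeighborIn E ↔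
      ∃ v, X.graph.Adj X.root v ∧ (X.reroot v).toSpace ∈ E := by
  constructor
  · rintro ⟨Y, v, hYX, hv, hE⟩
    obtain ⟨e, he⟩ : RootedIso Y.graph Y.root X.graph X.root := Quotient.exact hYX
    refine ⟨e v, he ▸ e.map_rel_iff.2 hv, ?_⟩
    have : (Y.reroot v).toSpace = (X.reroot (e v)).toSpace := Quotient.sound ⟨e, rfl⟩
    rwa [← this]
  · rintro ⟨v, hv, hE⟩
    exact ⟨X, v, rfl, hv, hE⟩

theorem hasNeighborIn_iUnion {Δ : ℕ} {ι : Sort*} (E : ι → Set (RootedGraphSpace Δ)) :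
    hasNeighborIn (⋃ i, E i) = ⋃ i, hasNeighborIn (E i) := by
  ext x
  simp only [hasNeighborIn, Set.mem_iUnion, Set.mem_ofPred_eq]
  constructor
  · rintro ⟨X, v, h1, h2, i, h3⟩
    exact ⟨i, X, v, h1, h2, h3⟩
  · rintro ⟨i, X, v, h1, h2, h3⟩
    exact ⟨X, v, h1, h2, i, h3⟩

theorem hasNeighborIn_mono {Δ : ℕ} {E F : Set (RootedGraphSpace Δ)} (h : E ⊆ F) :
    hasNeighborIn E ⊆ hasNeighborIn F := by
  rintro x ⟨X, v, h1, h2, h3⟩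
  exact ⟨X, v, h1, h2, h h3⟩

theorem IsLocal.hasNeighborIn {Δ r : ℕ} {E : Set (RootedGraphSpace Δ)} (h : IsLocal r E) :
    IsLocal (r + 1) (hasNeighborIn E) := by
  intro x y hxy hx
  induction x, y using Quotient.inductionOn₂ with
  | h X Y =>
    obtain ⟨v, hv, hE⟩ := toSpace_mem_hasNeighborIn.1 hx
    obtain ⟨w, hw, hvw⟩ := (ballSetoid_toSpace.1 hxy).exists_neighbor hv
    exact toSpace_mem_hasNeighborIn.2 ⟨w, hw, h (ballSetoid_toSpace.2 hvw) hE⟩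

end RootedGraphSpace

/-! ### Balls in graphs of bounded degree -/

theorem exists_adj_of_mem_ballSet_succ {V : Type*} {G : SimpleGraph V} {o w : V} {r : ℕ}
    (hw : w ∈ ballSet G o (r + 1)) : w = o ∨ ∃ v ∈ ballSet G o r, G.Adj v w := by
  have hw' : G.edist o w ≤ ((r + 1 : ℕ) : ℕ∞) := hw
  obtain ⟨p, hp⟩ := SimpleGraph.exists_walk_of_edist_ne_top
    (ne_top_of_le_ne_top (ENat.natCast_ne_top _) hw')
  rw [← hp] at hw'
  have hlen : p.reverse.length ≤ r + 1 := by
    rw [SimpleGraph.Walk.length_reverse]; exact_mod_cast hw'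
  cases hq : p.reverse with
  | nil => exact Or.inl rfl
  | @cons _ v _ hwv q =>
    rw [hq, SimpleGraph.Walk.length_cons] at hlen
    refine Or.inr ⟨v, ?_, hwv.symm⟩
    change G.edist o v ≤ r
    rw [SimpleGraph.edist_comm]
    exact (SimpleGraph.edist_le q).trans (by exact_mod_cast Nat.le_of_succ_le_succ hlen)

/-- Adjoining to each vertex its at most `Δ` neighbours multiplies the size by at most `Δ + 1`. -/
theorem exists_finset_ballSet_subset {V : Type*} {G : SimpleGraph V} {Δ : ℕ}
    (hdeg : ∀ v, (G.neighborSet v).encard ≤ Δ) (o : V) (r : ℕ) :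
    ∃ F : Finset V, ballSet G o r ⊆ F ∧ F.card ≤ (Δ + 1) ^ r := by
  classical
  have hfin (v : V) : (G.neighborSet v).Finite :=
    Set.finite_of_encard_le_coe (hdeg v)
  induction r with
  | zero =>
    refine ⟨{o}, fun w hw ↦ ?_, by simp⟩
    have : w = o := by simpa [ballSet] using hw
    simp [this]
  | succ r ih =>
    obtain ⟨F, hF, hcard⟩ := ih
    refine ⟨F.biUnion fun v ↦ insert v (hfin v).toFinset, fun w hw ↦ ?_, ?_⟩
    · simp only [Finset.coe_biUnion, Set.mem_iUnion, Finset.coe_insert, Set.Finite.coe_toFinset]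
      rcases exists_adj_of_mem_ballSet_succ hw with rfl | ⟨v, hv, hvw⟩
      · exact ⟨w, hF (mem_ballSet_self G w r), Or.inl rfl⟩
      · exact ⟨v, hF hv, Or.inr hvw⟩
    · refine (Finset.card_biUnion_le_card_mul _ _ (Δ + 1) fun v _ ↦ ?_).trans ?_
      · refine (Finset.card_insert_le _ _).trans (Nat.succ_le_succ ?_)
        have h := hdeg v
        rw [(hfin v).encard_eq_coe_toFinset_card] at h
        exact_mod_cast h
      · rw [pow_succ]
        exact Nat.mul_le_mul_right _ hcard

theorem finite_ballSet {V : Type*} {G : SimpleGraph V} {Δ : ℕ}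
    (hdeg : ∀ v, (G.neighborSet v).encard ≤ Δ) (o : V) (r : ℕ) : (ballSet G o r).Finite := by
  obtain ⟨F, hF, -⟩ := exists_finset_ballSet_subset hdeg o r
  exact F.finite_toSet.subset hF

theorem connected_ballGraph {V : Type*} (G : SimpleGraph V) (o : V) (r : ℕ) :
    (ballGraph G o r).Connected := by
  have key (v : ballSet G o r) : (ballGraph G o r).Reachable (ballRoot G o r) v := by
    refine SimpleGraph.reachable_of_edist_ne_top ?_
    rw [edist_ballGraph]
    exact ne_top_of_le_ne_top (ENat.natCast_ne_top r) v.2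
  have : Nonempty (ballSet G o r) := ⟨ballRoot G o r⟩
  exact ⟨fun u v ↦ (key u).symm.trans (key v)⟩

theorem RootedGraph.finite_ball {Δ : ℕ} (X : RootedGraph Δ) (r : ℕ) :
    Finite (ballSet X.graph X.root r) :=
  (finite_ballSet X.degree_le X.root r).to_subtype

namespace RootedGraphSpace

/-- There are finitely many balls of a given radius in graphs with degrees at most `Δ`. -/
instance finite_quotient_ballSetoid (Δ r : ℕ) : Finite (Quotient (ballSetoid Δ r)) := by
  -- Each ball is relabelled as a rooted graph on `Fin k` with `k ≤ (Δ + 1) ^ r`. There are finitely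
  -- many such codes, and equal codes mean isomorphic balls.
  have key (x : RootedGraphSpace Δ) :
      ∃ i : Σ k : Fin ((Δ + 1) ^ r + 1), SimpleGraph (Fin k) × Fin k, HasBall i.2.1 i.2.2 r x := by
    induction x using Quotient.inductionOn with
    | h X =>
      have := X.finite_ball r
      have := Fintype.ofFinite (ballSet X.graph X.root r)
      have hle : Fintype.card (ballSet X.graph X.root r) < (Δ + 1) ^ r + 1 := by
        obtain ⟨F, hF, hcard⟩ := exists_finset_ballSet_subset X.degree_le X.root r
        rw [Nat.lt_succ_iff, ← Nat.card_eq_fintype_card]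
        calc Nat.card (ballSet X.graph X.root r) = (ballSet X.graph X.root r).ncard := rfl
          _ ≤ (F : Set X.V).ncard := Set.ncard_le_ncard hF F.finite_toSet
          _ = F.card := Set.ncard_coe_finset F
          _ ≤ _ := hcard
      let e := (ballGraph X.graph X.root r).overFinIso rfl
      exact ⟨⟨⟨_, hle⟩, (ballGraph X.graph X.root r).overFin rfl, e (ballRoot X.graph X.root r)⟩,
        e, rfl⟩
  choose φ hφ using key
  refine Finite.of_injective (fun q : Quotient (ballSetoid Δ r) ↦ φ q.out) fun q q' h ↦ ?_
  rw [← q.out_eq, ← q'.out_eq]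
  refine Quotient.sound ?_
  have h1 := hφ q.out
  have h2 := hφ q'.out
  rw [← show φ q.out = φ q'.out from h] at h2
  generalize q.out = x at h1 h2 ⊢
  generalize q'.out = y at h1 h2 ⊢
  generalize φ x = i at h1 h2 ⊢
  induction x, y using Quotient.inductionOn₂ with
  | h X Y => exact RootedIso.trans h1 (RootedIso.symm h2)

/-- The equivalence classes of `ballSetoid` are the events that the ball of radius `r` is isomorphic
to a given finite connected rooted graph. -/
theorem exists_hasBall_iff {Δ : ℕ} (r : ℕ) (x : RootedGraphSpace Δ) :
    ∃ (W : Type) (_ : Finite W) (H : SimpleGraph W) (p : W), H.Connected ∧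
      ∀ y, ballSetoid Δ r x y ↔ HasBall H p r y := by
  induction x using Quotient.inductionOn with
  | h X =>
    refine ⟨_, X.finite_ball r, ballGraph X.graph X.root r, ballRoot X.graph X.root r,
      connected_ballGraph _ _ _, fun y ↦ ?_⟩
    induction y using Quotient.inductionOn with
    | h Y => exact ⟨RootedIso.symm, RootedIso.symm⟩

end RootedGraphSpace

/-! ### The random root of a finite graph -/

section sample
variable {V : Type*} [Fintype V]

/-- A finite connected graph with root `u`, as a point of the space of rooted graphs. -/
noncomputable def sampleGraph {Δ : ℕ} {G : SimpleGraph V} (hconn : G.Connected)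
    (hdeg : ∀ v, (G.neighborSet v).encard ≤ Δ) (u : V) : RootedGraph Δ where
  -- The vertex type may live in any universe, whereas points of the space are represented in
  -- `Type`.
  V := Fin (Fintype.card V)
  graph := G.overFin rfl
  root := G.overFinIso rfl u
  connected := (G.overFinIso rfl).connected_iff.1 hconn
  degree_le v := by
    obtain ⟨w, rfl⟩ := (G.overFinIso rfl).surjective v
    refine le_trans ?_ (hdeg w)
    rw [← (G.overFinIso rfl).injective.encard_image (G.neighborSet w)]
    refine Set.encard_le_encard fun z hz ↦ ?_
    obtain ⟨z, rfl⟩ := (G.overFinIso rfl).surjective z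
    exact ⟨z, (G.overFinIso rfl).map_rel_iff.1 hz, rfl⟩

variable {Δ : ℕ} {G : SimpleGraph V} (hconn : G.Connected)
  (hdeg : ∀ v, (G.neighborSet v).encard ≤ Δ)

/-- The fraction of the roots `u` for which `(G, u)` is in `E`. -/
noncomputable def sampleProb (E : Set (RootedGraphSpace Δ)) : ℝ :=
  ({u | (sampleGraph hconn hdeg u).toSpace ∈ E}.ncard : ℝ) / Fintype.card V

theorem sampleProb_hasBall {W : Type} (H : SimpleGraph W) (p : W) (R : ℕ) :
    sampleProb hconn hdeg {x | x.HasBall H p R} = uniformBallProb G R H p := by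
  have key (u : V) : BallIso G u (G.overFin rfl) (G.overFinIso rfl u) R :=
    RootedIso.ballIso ⟨G.overFinIso rfl, rfl⟩ R
  have : {u | (sampleGraph hconn hdeg u).toSpace ∈ {x | x.HasBall H p R}} =
      {u : V | RootedIso (ballGraph G u R) (ballRoot G u R) H p} := by
    ext u
    exact ⟨fun h ↦ (key u).trans h, fun h ↦ (RootedIso.symm (key u)).trans h⟩
  rw [sampleProb, uniformBallProb, this]

end sample

/-- By symmetry of adjacency, this set is the union of the neighbourhoods of the vertices of `T`. -/
theorem ncard_setOf_exists_adj_le {V : Type*} [Finite V] {Δ : ℕ} {G : SimpleGraph V}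
    (hdeg : ∀ v, (G.neighborSet v).encard ≤ Δ) (T : Set V) :
    {u | ∃ v, G.Adj u v ∧ v ∈ T}.ncard ≤ Δ * T.ncard := by
  classical
  have := Fintype.ofFinite V
  have h : {u | ∃ v, G.Adj u v ∧ v ∈ T} =
      ((T.toFinset.biUnion fun v ↦ (G.neighborSet v).toFinset : Finset V) : Set V) := by
    ext u
    simp [and_comm, SimpleGraph.adj_comm]
  rw [h, Set.ncard_coe_finset, Set.ncard_eq_toFinset_card', mul_comm]
  refine Finset.card_biUnion_le_card_mul _ _ _ fun v _ ↦ ?_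
  have h := hdeg v
  rw [Set.encard_eq_coe_toFinset_card] at h
  exact_mod_cast h

section sample
variable {V : Type*} [Fintype V] {Δ : ℕ} {G : SimpleGraph V} (hconn : G.Connected)
  (hdeg : ∀ v, (G.neighborSet v).encard ≤ Δ)

theorem sampleProb_biUnion {ι : Type*} (s : Finset ι) (E : ι → Set (RootedGraphSpace Δ))
    (hE : (s : Set ι).PairwiseDisjoint E) :
    sampleProb hconn hdeg (⋃ i ∈ s, E i) = ∑ i ∈ s, sampleProb hconn hdeg (E i) := by
  classical
  simp only [sampleProb, ← Finset.sum_div]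
  congr 1
  rw [← Nat.cast_sum]
  congr 1
  have h : {u | (sampleGraph hconn hdeg u).toSpace ∈ ⋃ i ∈ s, E i} =
      ((s.biUnion fun i ↦ {u | (sampleGraph hconn hdeg u).toSpace ∈ E i}.toFinset : Finset V) :
        Set V) := by
    ext u; simp
  rw [h, Set.ncard_coe_finset, Finset.card_biUnion]
  · exact Finset.sum_congr rfl fun i _ ↦ (Set.ncard_eq_toFinset_card' _).symm
  · intro i hi j hj hij
    refine Finset.disjoint_left.2 fun u hu hu' ↦ ?_
    simp only [Set.mem_toFinset, Set.mem_ofPred_eq] at hu hu'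
    exact Set.disjoint_left.1 (hE hi hj hij) hu hu'

/-- Mass transport: at most `Δ` roots have a given neighbour. -/
theorem sampleProb_hasNeighborIn_le (E : Set (RootedGraphSpace Δ)) :
    sampleProb hconn hdeg (RootedGraphSpace.hasNeighborIn E) ≤
      Δ * sampleProb hconn hdeg E := by
  have h : {u | (sampleGraph hconn hdeg u).toSpace ∈ RootedGraphSpace.hasNeighborIn E} ⊆
      {u | ∃ v, G.Adj u v ∧ v ∈ {v | (sampleGraph hconn hdeg v).toSpace ∈ E}} := by
    intro u hu
    obtain ⟨w, hw, hE⟩ := RootedGraphSpace.toSpace_mem_hasNeighborIn.1 hu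
    obtain ⟨v, rfl⟩ := (G.overFinIso rfl).surjective w
    exact ⟨v, (G.overFinIso rfl).map_rel_iff.1 hw, hE⟩
  rw [sampleProb, sampleProb, ← mul_div_assoc]
  refine div_le_div_of_nonneg_right ?_ (Nat.cast_nonneg _)
  exact_mod_cast (Set.ncard_le_ncard h (Set.toFinite _)).trans (ncard_setOf_exists_adj_le hdeg _)

end sample

/-! ### Expansion -/

theorem edgesBetween_comm {V : Type*} (G : SimpleGraph V) (A B : Set V) :
    edgesBetween G A B = edgesBetween G B A := by
  ext e
  constructor <;> rintro ⟨he, a, ha, b, hb, rfl⟩ <;> exact ⟨he, b, hb, a, ha, Sym2.eq_swap⟩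

section expansion
variable {V : Type*} [Fintype V] {G : SimpleGraph V} {c : ℝ}

theorem mul_ncard_le_ncard_edgesBetween (hc : ENNReal.ofReal c ≤ cheegerConstant G) (A : Set V)
    (hA : 2 * A.ncard ≤ Fintype.card V) :
    c * A.ncard ≤ (edgesBetween G A Aᶜ).ncard := by
  classical
  rcases Nat.eq_zero_or_pos A.ncard with h0 | hpos
  · simp [h0]
  have hcard : A.toFinset.card = A.ncard := (Set.ncard_eq_toFinset_card' A).symm
  have h : cheegerConstant G ≤ _ := iInf₂_le A.toFinset ⟨by rwa [hcard], by rwa [hcard]⟩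
  rw [hcard, Set.coe_toFinset] at h
  have h' := hc.trans h
  rw [ENNReal.le_div_iff_mul_le (by simp [hpos.ne']) (by simp),
    ← ENNReal.ofReal_natCast, ← ENNReal.ofReal_natCast, ← ENNReal.ofReal_mul' (by positivity),
    ENNReal.ofReal_le_ofReal_iff (by positivity)] at h'
  exact h'

/-- The Cheeger bound is applied to the smaller of `A` and its complement, which have the same edge
boundary. -/
theorem mul_min_ncard_le_ncard_edgesBetween (hc0 : 0 ≤ c)
    (hc : ENNReal.ofReal c ≤ cheegerConstant G) (A : Set V) :
    c * min (A.ncard : ℝ) (Aᶜ.ncard) ≤ (edgesBetween G A Aᶜ).ncard := by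
  have hsum := Set.ncard_add_ncard_compl A
  rw [Nat.card_eq_fintype_card] at hsum
  rcases le_total A.ncard Aᶜ.ncard with h | h
  · refine (mul_le_mul_of_nonneg_left (min_le_left _ _) hc0).trans ?_
    exact mul_ncard_le_ncard_edgesBetween hc A (by omega)
  · refine (mul_le_mul_of_nonneg_left (min_le_right _ _) hc0).trans ?_
    rw [edgesBetween_comm]
    simpa using mul_ncard_le_ncard_edgesBetween hc Aᶜ (by omega)

/-- A component with nonempty complement would have empty edge boundary, against positive expansion.
-/
theorem connected_of_le_cheegerConstant [Nonempty V] (hc0 : 0 < c)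
    (hc : ENNReal.ofReal c ≤ cheegerConstant G) : G.Connected := by
  refine ⟨fun u v ↦ ?_⟩
  by_contra huv
  have h := mul_min_ncard_le_ncard_edgesBetween hc0.le hc {w | G.Reachable u w}
  have hE : edgesBetween G {w | G.Reachable u w} {w | G.Reachable u w}ᶜ = ∅ := by
    refine Set.eq_empty_of_forall_notMem ?_
    rintro _ ⟨he, a, ha, b, hb, rfl⟩
    exact hb (SimpleGraph.Reachable.trans ha (SimpleGraph.Adj.reachable he))
  rw [hE] at h
  have h1 : 0 < {w | G.Reachable u w}.ncard :=
    (Set.ncard_pos (Set.toFinite _)).2 ⟨u, SimpleGraph.Reachable.refl u⟩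
  have h2 : 0 < {w | G.Reachable u w}ᶜ.ncard := (Set.ncard_pos (Set.toFinite _)).2 ⟨v, huv⟩
  have : 0 < c * min ({w | G.Reachable u w}.ncard : ℝ) ({w | G.Reachable u w}ᶜ.ncard) := by
    have := lt_min (Nat.cast_pos (α := ℝ).2 h1) (Nat.cast_pos (α := ℝ).2 h2)
    positivity
  simp at h
  linarith

/-- Each boundary edge is charged to its endpoint in `A`, which receives at most `Δ` charges. -/
theorem ncard_edgesBetween_compl_le {Δ : ℕ} (hdeg : ∀ v, (G.neighborSet v).encard ≤ Δ)
    (A : Set V) :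
    (edgesBetween G A Aᶜ).ncard ≤ Δ * {u | u ∈ A ∧ ∃ v, G.Adj u v ∧ v ∈ Aᶜ}.ncard := by
  classical
  set B : Set V := {u | u ∈ A ∧ ∃ v, G.Adj u v ∧ v ∈ Aᶜ}
  have hsub : edgesBetween G A Aᶜ ⊆
      ((B.toFinset.biUnion fun u ↦ (G.neighborSet u).toFinset.image fun v ↦ s(u, v) :
        Finset (Sym2 V)) : Set (Sym2 V)) := by
    rintro _ ⟨he, a, ha, b, hb, rfl⟩
    have hab : G.Adj a b := he
    simp only [Finset.mem_coe, Finset.mem_biUnion, Set.mem_toFinset, Finset.mem_image,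
      SimpleGraph.mem_neighborSet]
    exact ⟨a, ⟨ha, b, hab, hb⟩, b, hab, rfl⟩
  refine (Set.ncard_le_ncard hsub (Finset.finite_toSet _)).trans ?_
  rw [Set.ncard_coe_finset, Set.ncard_eq_toFinset_card' B, mul_comm]
  refine Finset.card_biUnion_le_card_mul _ _ _ fun u _ ↦ Finset.card_image_le.trans ?_
  have h := hdeg u
  rw [Set.encard_eq_coe_toFinset_card] at h
  exact_mod_cast h

/-- Expansion in the language of the random root: the edge boundary is replaced by the inner vertex
boundary, at the cost of a factor `Δ`, so that it becomes an event of the rooted graph. -/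
theorem mul_min_sampleProb_le [Nonempty V] {Δ : ℕ} (hc0 : 0 ≤ c)
    (hc : ENNReal.ofReal c ≤ cheegerConstant G) (hconn : G.Connected)
    (hdeg : ∀ v, (G.neighborSet v).encard ≤ Δ) (E : Set (RootedGraphSpace Δ)) :
    c * min (sampleProb hconn hdeg E) (1 - sampleProb hconn hdeg E) ≤
      Δ * sampleProb hconn hdeg (E ∩ RootedGraphSpace.hasNeighborIn Eᶜ) := by
  set A : Set V := {u | (sampleGraph hconn hdeg u).toSpace ∈ E} with hA
  have hV : (0 : ℝ) < Fintype.card V := by exact_mod_cast Fintype.card_pos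
  have hsub : {u | u ∈ A ∧ ∃ v, G.Adj u v ∧ v ∈ Aᶜ} ⊆
      {u | (sampleGraph hconn hdeg u).toSpace ∈ E ∩ RootedGraphSpace.hasNeighborIn Eᶜ} := by
    rintro u ⟨hu, v, huv, hv⟩
    exact ⟨hu, RootedGraphSpace.toSpace_mem_hasNeighborIn.2
      ⟨G.overFinIso rfl v, (G.overFinIso rfl).map_rel_iff.2 huv, hv⟩⟩
  have h1 := mul_min_ncard_le_ncard_edgesBetween hc0 hc A
  have h2 : ((edgesBetween G A Aᶜ).ncard : ℝ) ≤ Δ * ({u | (sampleGraph hconn hdeg u).toSpace ∈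
      E ∩ RootedGraphSpace.hasNeighborIn Eᶜ}.ncard : ℝ) := by
    exact_mod_cast (ncard_edgesBetween_compl_le hdeg A).trans
      (Nat.mul_le_mul_left _ (Set.ncard_le_ncard hsub (Set.toFinite _)))
  have hsum : (A.ncard : ℝ) + Aᶜ.ncard = Fintype.card V := by
    have := Set.ncard_add_ncard_compl A
    rw [Nat.card_eq_fintype_card] at this
    exact_mod_cast this
  have h3 : 1 - sampleProb hconn hdeg E = Aᶜ.ncard / Fintype.card V := by
    rw [sampleProb, eq_div_iff hV.ne', sub_mul, div_mul_cancel₀ _ hV.ne', ← hsum]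
    ring
  rw [h3, sampleProb, sampleProb, ← mul_div_assoc, min_div_div_right hV.le, ← mul_div_assoc]
  exact div_le_div_of_nonneg_right (h1.trans h2) hV.le

end expansion

/-! ### Convergence of local events -/

namespace RootedGraphSpace
variable {Δ : ℕ} {V : ℕ → Type*} [∀ n, Fintype (V n)] {G : ∀ n, SimpleGraph (V n)}
  {μ : Measure (RootedGraphSpace Δ)}

/-- Bounded degree leaves finitely many balls of a given radius, so a local event is a finite
disjoint union of events to which the convergence hypothesis applies. -/
theorem tendsto_sampleProb [IsFiniteMeasure μ] (hconv : ConvergesLocallyWeakly G μ)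
    (hconn : ∀ n, (G n).Connected) (hdeg : ∀ n v, ((G n).neighborSet v).encard ≤ Δ)
    {r : ℕ} {E : Set (RootedGraphSpace Δ)} (hE : IsLocal r E) :
    Tendsto (fun n ↦ sampleProb (hconn n) (hdeg n) E) atTop (𝓝 (μ.real E)) := by
  classical
  -- The hypothesis covers positive radii only, so the radius is raised by one.
  replace hE := hE.mono (Nat.le_succ r)
  generalize r.succ = R, r.succ_pos = hR at hE
  have := Fintype.ofFinite (Quotient (ballSetoid Δ R))
  let C (q : Quotient (ballSetoid Δ R)) : Set (RootedGraphSpace Δ) := {x | ballSetoid Δ R q.out x}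
  have hmem (q) (x) : x ∈ C q ↔ Quotient.mk _ x = q :=
    ⟨fun h ↦ (Quotient.sound h).symm.trans q.out_eq,
      fun h ↦ Quotient.exact (q.out_eq.trans h.symm)⟩
  have hCloc (q) : IsLocal R (C q) := fun _ _ hxy hx ↦ (ballSetoid Δ R).trans hx hxy
  let S : Finset (Quotient (ballSetoid Δ R)) := {q | q.out ∈ E}
  have hES : E = ⋃ q ∈ S, C q := by
    ext x
    simp only [Set.mem_iUnion, hmem, exists_prop, exists_eq_right']
    have hx : ballSetoid Δ R (Quotient.mk (ballSetoid Δ R) x).out x := Quotient.mk_out x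
    simp only [S, Finset.mem_filter, Finset.mem_univ, true_and]
    exact ⟨fun h ↦ hE ((ballSetoid Δ R).symm hx) h, fun h ↦ hE hx h⟩
  have hdisj : (S : Set (Quotient (ballSetoid Δ R))).PairwiseDisjoint C := by
    intro q _ q' _ hqq'
    refine Set.disjoint_left.2 fun x hx hx' ↦ hqq' ?_
    rw [← (hmem q x).1 hx, ← (hmem q' x).1 hx']
  have hμ : μ.real E = ∑ q ∈ S, μ.real (C q) := by
    conv_lhs => rw [hES]
    exact measureReal_biUnion_finset hdisj fun q _ ↦ (hCloc q).measurableSet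
  rw [hμ]
  conv => enter [1, n]; rw [hES, sampleProb_biUnion _ _ _ _ hdisj]
  refine tendsto_finsetSum _ fun q _ ↦ ?_
  obtain ⟨W, hW, H, p, hH, hiff⟩ := exists_hasBall_iff R q.out
  have hC : C q = {x | HasBall H p R x} := Set.ext hiff
  simp only [hC, sampleProb_hasBall]
  exact hconv R hR W H p hH

end RootedGraphSpace

/-! ### The limit inequalities and the zero-one law -/

namespace RootedGraphSpace
variable {Δ : ℕ} {V : ℕ → Type*} [∀ n, Fintype (V n)] {G : ∀ n, SimpleGraph (V n)}
  {μ : Measure (RootedGraphSpace Δ)}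

theorem measureReal_hasNeighborIn_le_of_isLocal [IsFiniteMeasure μ]
    (hconv : ConvergesLocallyWeakly G μ)
    (hconn : ∀ n, (G n).Connected) (hdeg : ∀ n v, ((G n).neighborSet v).encard ≤ Δ)
    {r : ℕ} {E : Set (RootedGraphSpace Δ)} (hE : IsLocal r E) :
    μ.real (hasNeighborIn E) ≤ Δ * μ.real E :=
  le_of_tendsto_of_tendsto' (tendsto_sampleProb hconv hconn hdeg hE.hasNeighborIn)
    ((tendsto_sampleProb hconv hconn hdeg hE).const_mul _)
    fun _ ↦ sampleProb_hasNeighborIn_le _ _ E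

/-- Mass transport in the limit. -/
theorem measureReal_hasNeighborIn_le [IsFiniteMeasure μ] (hconv : ConvergesLocallyWeakly G μ)
    (hconn : ∀ n, (G n).Connected) (hdeg : ∀ n v, ((G n).neighborSet v).encard ≤ Δ)
    {U : Set (RootedGraphSpace Δ)} (hU : IsOpen U) :
    μ.real (hasNeighborIn U) ≤ Δ * μ.real U := by
  -- `hasNeighborIn` commutes with unions, so continuity from below extends the local case to open
  -- sets.
  have h : Tendsto (fun r ↦ μ (hasNeighborIn (localCore r U))) atTop
      (𝓝 (μ (hasNeighborIn U))) := by
    conv => enter [3, 1]; rw [← iUnion_localCore hU, hasNeighborIn_iUnion]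
    exact tendsto_measure_iUnion_atTop fun r s hrs ↦
      hasNeighborIn_mono (monotone_localCore U hrs)
  refine le_of_tendsto' ((ENNReal.tendsto_toReal (measure_ne_top _ _)).comp h) fun r ↦ ?_
  refine (measureReal_hasNeighborIn_le_of_isLocal hconv hconn hdeg
    (isLocal_localCore U r)).trans ?_
  exact mul_le_mul_of_nonneg_left (measureReal_mono (localCore_subset U r)) (Nat.cast_nonneg _)

/-- Only local events occur, the boundary event having radius `r + 1`, so the inequality for `G n`
survives the limit. -/
theorem mul_min_measureReal_le [IsProbabilityMeasure μ] [∀ n, Nonempty (V n)] {c : ℝ} (hc : 0 ≤ c)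
    (hcheeger : ∀ n, ENNReal.ofReal c ≤ cheegerConstant (G n))
    (hconv : ConvergesLocallyWeakly G μ)
    (hconn : ∀ n, (G n).Connected) (hdeg : ∀ n v, ((G n).neighborSet v).encard ≤ Δ)
    {r : ℕ} {E : Set (RootedGraphSpace Δ)} (hE : IsLocal r E) :
    c * min (μ.real E) (1 - μ.real E) ≤ Δ * μ.real (E ∩ hasNeighborIn Eᶜ) := by
  have h1 := tendsto_sampleProb hconv hconn hdeg hE
  have h2 := tendsto_sampleProb hconv hconn hdeg
    ((hE.mono (Nat.le_succ r)).inter hE.compl.hasNeighborIn)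
  exact le_of_tendsto_of_tendsto' ((h1.min (h1.const_sub 1)).const_mul c) (h2.const_mul _)
    fun n ↦ mul_min_sampleProb_le hc (hcheeger n) _ _ E

/-- A measurable event that does not depend on the position of the root is trivial under the local
weak limit of a sequence of expanders. -/
theorem measureReal_eq_zero_or_one [IsProbabilityMeasure μ] [∀ n, Nonempty (V n)] {c : ℝ}
    (hc : 0 < c) (hcheeger : ∀ n, ENNReal.ofReal c ≤ cheegerConstant (G n))
    (hdeg : ∀ n v, ((G n).neighborSet v).encard ≤ Δ) (hconv : ConvergesLocallyWeakly G μ)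
    {A : Set (RootedGraphSpace Δ)} (hA : MeasurableSet A)
    (hinv : ∀ (X : RootedGraph Δ) (v w : X.V), (X.reroot v).toSpace ∈ A →
      (X.reroot w).toSpace ∈ A) :
    μ.real A = 0 ∨ μ.real A = 1 := by
  have hconn (n) : (G n).Connected := connected_of_le_cheegerConstant hc (hcheeger n)
  have key (ε : ℝ) (hε : 0 < ε) :
      c * min (μ.real A) (1 - μ.real A) ≤ (Δ * (1 + Δ) + c) * ε := by
    obtain ⟨U, hAU, hU, -, hUA⟩ := hA.exists_isOpen_sdiff_lt (μ := μ) (measure_ne_top _ _)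
      (ENNReal.ofReal_pos.2 hε).ne'
    have hUA' : μ.real (U \ A) < ε := by
      rw [measureReal_def]
      exact (ENNReal.lt_ofReal_iff_toReal_lt (measure_ne_top _ _)).1 hUA
    have hlim : Tendsto (fun r ↦ μ.real (localCore r U)) atTop (𝓝 (μ.real U)) := by
      have h := tendsto_measure_iUnion_atTop (μ := μ) (monotone_localCore U)
      rw [iUnion_localCore hU] at h
      exact (ENNReal.tendsto_toReal (measure_ne_top _ _)).comp h
    obtain ⟨r, hr⟩ := (hlim.eventually_const_lt (sub_lt_self _ hε)).exists
    have hE := isLocal_localCore U r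
    have hEU := localCore_subset U r
    generalize localCore r U = E at hr hE hEU
    have hUE : μ.real (U \ E) ≤ ε := by
      rw [measureReal_sdiff hEU hE.measurableSet]
      linarith
    -- The only use of invariance: a root in `A` has all its neighbours in `A ⊆ U`, so a neighbour
    -- outside `E` lies in `U \ E`.
    have hsub : E ∩ hasNeighborIn Eᶜ ⊆ (U \ A) ∪ hasNeighborIn (U \ E) := by
      rintro _ ⟨hxE, X, v, rfl, hv, hvE⟩
      by_cases hX : X.toSpace ∈ A
      · exact Or.inr ⟨X, v, rfl, hv, hAU (hinv X X.root v hX), hvE⟩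
      · exact Or.inl ⟨hEU hxE, hX⟩
    -- Local events are clopen, so the difference stays open and mass transport applies.
    have hopen : IsOpen (U \ E) := hU.inter hE.compl.isOpen
    have h1 := mul_min_measureReal_le hc.le hcheeger hconv hconn hdeg hE
    have h2 : μ.real (E ∩ hasNeighborIn Eᶜ) ≤ ε + Δ * ε := by
      refine (measureReal_mono hsub).trans ((measureReal_union_le _ _).trans ?_)
      refine add_le_add hUA'.le ((measureReal_hasNeighborIn_le hconv hconn hdeg hopen).trans ?_)
      exact mul_le_mul_of_nonneg_left hUE (Nat.cast_nonneg _)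
    have h3 : μ.real A ≤ μ.real E + ε := by
      have := measureReal_mono (μ := μ) hAU
      linarith
    have h4 : μ.real E ≤ μ.real A + ε := by
      have h := measureReal_mono (μ := μ) hEU
      rw [measureReal_sdiff hAU hA] at hUA'
      linarith
    -- The measures of `A` and `E` differ by at most `ε`, and so do the two minima.
    have h5 : min (μ.real A) (1 - μ.real A) ≤ min (μ.real E) (1 - μ.real E) + ε := by
      rw [min_add]
      exact min_le_min h3 (by linarith)
    calc c * min (μ.real A) (1 - μ.real A) ≤ c * (min (μ.real E) (1 - μ.real E) + ε) :=
          mul_le_mul_of_nonneg_left h5 hc.le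
      _ = c * min (μ.real E) (1 - μ.real E) + c * ε := mul_add _ _ _
      _ ≤ Δ * (ε + Δ * ε) + c * ε := by
          exact add_le_add_left (h1.trans (mul_le_mul_of_nonneg_left h2 (Nat.cast_nonneg _))) _
      _ = _ := by ring
  have hle : c * min (μ.real A) (1 - μ.real A) ≤ 0 := by
    have hK : (0 : ℝ) < Δ * (1 + Δ) + c := by positivity
    refine le_of_forall_pos_le_add fun δ hδ ↦ ?_
    have h := key (δ / (Δ * (1 + Δ) + c)) (by positivity)
    rwa [mul_div_cancel₀ _ hK.ne', ← zero_add δ] at h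
  have hmin : min (μ.real A) (1 - μ.real A) ≤ 0 := nonpos_of_mul_nonpos_right hle hc
  rcases min_le_iff.1 hmin with h | h
  · exact Or.inl (le_antisymm h measureReal_nonneg)
  · exact Or.inr (le_antisymm measureReal_le_one (by linarith))

theorem exists_ae_eq_const [IsProbabilityMeasure μ] [∀ n, Nonempty (V n)] {c : ℝ}
    (hc : 0 < c) (hcheeger : ∀ n, ENNReal.ofReal c ≤ cheegerConstant (G n))
    (hdeg : ∀ n v, ((G n).neighborSet v).encard ≤ Δ) (hconv : ConvergesLocallyWeakly G μ)
    {f : RootedGraphSpace Δ → ℝ} (hf : Measurable f) (hinv : RootInvariant f) :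
    ∃ a : ℝ, ∀ᵐ x ∂μ, f x = a := by
  -- Measurable sets of reals include a countable family separating points, so triviality of every
  -- preimage pins `f` to one value.
  refine exists_eventuallyEq_const_of_forall_separating (p := MeasurableSet) (l := ae μ) (f := f)
    fun S hS ↦ ?_
  rcases measureReal_eq_zero_or_one hc hcheeger hdeg hconv (hf hS) fun X v w h ↦ by
    simpa only [Set.mem_preimage, hinv X w v] using h with h | h
  · right
    rw [measureReal_eq_zero_iff] at h
    exact measure_eq_zero_iff_ae_notMem.1 h
  · left
    rw [measureReal_def, ENNReal.toReal_eq_one_iff] at h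
    exact (prob_compl_eq_zero_iff (hf hS)).2 h

end RootedGraphSpace

/-! ### Product measures -/

/-- A marginal of an i.i.d. family is i.i.d.: a box pulls back to a box that is unconstrained off
the range of `g`. -/
theorem infinitePi_map_comp_of_injective {α β Y : Type*} [MeasurableSpace Y] (ν : Measure Y)
    [IsProbabilityMeasure ν] {g : α → β} (hg : Function.Injective g) :
    (Measure.infinitePi fun _ : β ↦ ν).map (fun x ↦ x ∘ g) = Measure.infinitePi fun _ : α ↦ ν := by
  refine Measure.eq_infinitePi _ fun s t ht ↦ ?_
  have hmeas : Measurable fun (x : β → Y) ↦ x ∘ g :=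
    measurable_pi_lambda _ fun a ↦ measurable_pi_apply (g a)
  rw [Measure.map_apply hmeas (MeasurableSet.pi s.countable_toSet fun i _ ↦ ht i)]
  have h : (fun (x : β → Y) ↦ x ∘ g) ⁻¹' (Set.pi s t) =
      Set.pi (s.map ⟨g, hg⟩ : Finset β) (Function.extend g t fun _ ↦ Set.univ) := by
    ext x
    simp [Set.mem_pi, hg.extend_apply]
  rw [h, Measure.infinitePi_pi]
  · simp [hg.extend_apply]
  · intro i hi
    obtain ⟨a, -, rfl⟩ := Finset.mem_map.1 hi
    simpa [hg.extend_apply] using ht a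

section setBernoulli
open ProbabilityTheory unitInterval

/-- One coordinate of the coupling: a uniform label thresholded at `p` has the Bernoulli law, and an
index outside the set (`b` false) is never open. -/
theorem map_volume_and_le (b : Prop) (p : I) :
    (volume : Measure I).map (fun x ↦ b ∧ x ≤ p) =
      toNNReal p • Measure.dirac b + toNNReal (σ p) • Measure.dirac False := by
  have hp : (toNNReal p : ℝ≥0∞) + toNNReal (σ p) = 1 := by
    rw [← ENNReal.coe_add, toNNReal_add_toNNReal_symm, ENNReal.coe_one]
  have hm : Measurable fun x : I ↦ b ∧ x ≤ p :=
    measurable_const.and (measurableSet_setOfPred.1 measurableSet_Iic)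
  by_cases hb : b
  · refine Measure.ext_of_singleton fun c ↦ ?_
    rw [Measure.map_apply hm (measurableSet_singleton c)]
    by_cases hc : c
    · have : (fun x : I ↦ b ∧ x ≤ p) ⁻¹' {c} = Set.Iic p := by
        ext x; simp [hb, hc]
      rw [this, volume_Iic]
      have h1 : ENNReal.ofReal (p : ℝ) = toNNReal p := by
        rw [ENNReal.ofReal, Real.toNNReal_of_nonneg p.2.1]; rfl
      rw [h1, Measure.add_apply, Measure.coe_nnreal_smul_apply,
        Measure.coe_nnreal_smul_apply]
      simp [hb, hc]
    · have : (fun x : I ↦ b ∧ x ≤ p) ⁻¹' {c} = Set.Ioi p := by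
        ext x; simp [hb, hc]
      rw [this, volume_Ioi]
      have h1 : ENNReal.ofReal (1 - p : ℝ) = toNNReal (σ p) := by
        rw [ENNReal.ofReal, Real.toNNReal_of_nonneg (sub_nonneg.2 p.2.2)]; rfl
      rw [h1, Measure.add_apply, Measure.coe_nnreal_smul_apply,
        Measure.coe_nnreal_smul_apply]
      simp [hb, hc]
  · have : (fun x : I ↦ b ∧ x ≤ p) = fun _ ↦ False := by
      ext x; simp [hb]
    rw [this, Measure.map_const, eq_false hb]
    ext s hs
    rw [Measure.add_apply, Measure.coe_nnreal_smul_apply,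
        Measure.coe_nnreal_smul_apply]
    simp [← add_mul, hp]

variable {ι : Type*}

/-- The set of the elements of `u` whose label is at most `p`. -/
def sublevel (u : Set ι) (p : I) (x : ι → I) : Set ι := {i | i ∈ u ∧ x i ≤ p}

theorem measurable_sublevel (u : Set ι) (p : I) : Measurable (sublevel u p) := by
  refine measurable_set_iff.2 fun i ↦ ?_
  exact measurable_const.and
    (measurableSet_setOfPred.1
      ((measurable_pi_apply i : Measurable fun x : ι → I ↦ x i) measurableSet_Iic))

/-- Standard coupling of the measures `setBernoulli u p` for all `p`. -/
theorem setBernoulli_eq_map_sublevel (u : Set ι) (p : I) :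
    setBernoulli u p = (Measure.infinitePi fun _ : ι ↦ (volume : Measure I)).map
      (sublevel u p) := by
  have hm (i : ι) : Measurable fun x : I ↦ i ∈ u ∧ x ≤ p :=
    measurable_const.and (measurableSet_setOfPred.1 measurableSet_Iic)
  rw [setBernoulli_eq_map]
  simp only [← map_volume_and_le]
  rw [← Measure.infinitePi_map_pi _ hm, Measure.map_map]
  · rfl
  · exact MeasurableEquiv.setOfPred.measurable
  · exact measurable_pi_lambda _ fun i ↦ (hm i).comp (measurable_pi_apply i)

/-- In the coupling by uniform labels, raising the threshold only adds open elements. -/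
theorem setBernoulli_mono (u : Set ι) {p q : I} (hpq : p ≤ q) {S : Set (Set ι)}
    (hS : MeasurableSet S) (hup : IsUpperSet S) :
    setBernoulli u p S ≤ setBernoulli u q S := by
  rw [setBernoulli_eq_map_sublevel, setBernoulli_eq_map_sublevel,
    Measure.map_apply (measurable_sublevel u p) hS, Measure.map_apply (measurable_sublevel u q) hS]
  refine measure_mono fun x hx ↦ hup ?_ hx
  exact fun i hi ↦ ⟨hi.1, hi.2.trans hpq⟩

theorem measurable_preimage {α β : Type*} (g : α → β) :
    Measurable fun ω : Set β ↦ g ⁻¹' ω :=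
  measurable_set_iff.2 fun a ↦ measurable_set_mem (g a)

theorem setBernoulli_map_preimage {α β : Type*} {g : α → β} (hg : Function.Injective g)
    (u : Set β) (p : I) :
    (setBernoulli u p).map (fun ω ↦ g ⁻¹' ω) = setBernoulli (g ⁻¹' u) p := by
  have hmeas : Measurable fun (x : β → I) ↦ x ∘ g :=
    measurable_pi_lambda _ fun a ↦ measurable_pi_apply (g a)
  rw [setBernoulli_eq_map_sublevel, setBernoulli_eq_map_sublevel,
    Measure.map_map (measurable_preimage g) (measurable_sublevel u p),
    ← infinitePi_map_comp_of_injective volume hg,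
    Measure.map_map (measurable_sublevel _ p) hmeas]
  rfl

end setBernoulli

/-! ### Open paths leaving a ball -/

theorem openGraph_adj {V : Type*} {G : SimpleGraph V} {ω : Set (Sym2 V)} {a b : V} :
    (openGraph G ω).Adj a b ↔ G.Adj a b ∧ s(a, b) ∈ ω := by
  simp only [openGraph, SimpleGraph.fromEdgeSet_adj, Set.mem_inter_iff, SimpleGraph.mem_edgeSet]
  exact ⟨fun h ↦ h.1, fun h ↦ ⟨h, h.1.ne⟩⟩

theorem openGraph_mono {V : Type*} (G : SimpleGraph V) {ω ω' : Set (Sym2 V)} (h : ω ⊆ ω') :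
    openGraph G ω ≤ openGraph G ω' :=
  SimpleGraph.fromEdgeSet_mono (Set.inter_subset_inter_right _ h)

theorem isUpperSet_percolates {V : Type*} (G : SimpleGraph V) : IsUpperSet (percolates G) := by
  rintro ω ω' h ⟨C, hC⟩
  refine ⟨C.map (SimpleGraph.Hom.ofLE (openGraph_mono G h)), hC.mono ?_⟩
  rintro v rfl
  rfl

/-- The event that an open path joins the ball of radius `k` around `o` to some vertex at distance
at least `r` from `o`. -/
def armEvent {V : Type*} (G : SimpleGraph V) (o : V) (k r : ℕ) : Set (Set (Sym2 V)) :=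
  {ω | ∃ u w, G.edist o u ≤ k ∧ r ≤ G.edist o w ∧ (openGraph G ω).Reachable u w}

theorem armEvent_antitone {V : Type*} (G : SimpleGraph V) (o : V) (k : ℕ) :
    Antitone (armEvent G o k) := by
  rintro r s hrs ω ⟨u, w, hu, hw, h⟩
  exact ⟨u, w, hu, le_trans (by exact_mod_cast hrs) hw, h⟩

theorem armEvent_mono {V : Type*} (G : SimpleGraph V) (o : V) {k l : ℕ} (hkl : k ≤ l) (r : ℕ) :
    armEvent G o k r ⊆ armEvent G o l r := by
  rintro ω ⟨u, w, hu, hw, h⟩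
  exact ⟨u, w, hu.trans (by exact_mod_cast hkl), hw, h⟩

theorem sym2Map_val_injective {V : Type*} (s : Set V) :
    Function.Injective (Sym2.map (Subtype.val : s → V)) :=
  Sym2.map.injective Subtype.val_injective

/-- The path is stopped at its first vertex at distance at least `r`. All earlier vertices are at
distance below `r`, so the stopped path stays in the ball. -/
theorem exists_reachable_ballGraph {V : Type*} {G : SimpleGraph V} {ω : Set (Sym2 V)} {o : V}
    {r : ℕ} {u w : V} (p : (openGraph G ω).Walk u w) (hw : r ≤ G.edist o w)
    (hu : u ∈ ballSet G o r) :
    ∃ v : ballSet G o r, r ≤ G.edist o v ∧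
      (openGraph (ballGraph G o r) (Sym2.map Subtype.val ⁻¹' ω)).Reachable ⟨u, hu⟩ v := by
  induction p with
  | nil => exact ⟨_, hw, SimpleGraph.Reachable.refl _⟩
  | @cons a b c hab p ih =>
    by_cases ha : r ≤ G.edist o a
    · exact ⟨_, ha, SimpleGraph.Reachable.refl _⟩
    have hab' := openGraph_adj.1 hab
    have hb : b ∈ ballSet G o r := by
      change G.edist o b ≤ r
      calc G.edist o b ≤ G.edist o a + G.edist a b := SimpleGraph.edist_triangle
        _ ≤ G.edist o a + 1 := by gcongr; exact edist_le_one_of_adj hab'.1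
        _ ≤ r := Order.add_one_le_of_lt (not_le.1 ha)
    obtain ⟨v, hv, h⟩ := ih hw hb
    refine ⟨v, hv, SimpleGraph.Reachable.trans (SimpleGraph.Adj.reachable ?_) h⟩
    exact openGraph_adj.2 hab'

/-- Hence the arm event depends only on the edges inside a ball; this makes it measurable and makes
its probability a local function of the rooted graph. -/
theorem preimage_armEvent_ballGraph {V : Type*} (G : SimpleGraph V) (o : V) {k r : ℕ}
    (hkr : k ≤ r) :
    (fun ω ↦ Sym2.map Subtype.val ⁻¹' ω) ⁻¹'
      armEvent (ballGraph G o r) (ballRoot G o r) k r = armEvent G o k r := by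
  ext ω
  constructor
  · rintro ⟨u, w, hu, hw, h⟩
    rw [edist_ballGraph] at hu hw
    let f : openGraph (ballGraph G o r) (Sym2.map Subtype.val ⁻¹' ω) →g openGraph G ω :=
      { toFun := Subtype.val
        map_rel' := fun {a b} h ↦ by
          have h' := openGraph_adj.1 h
          exact openGraph_adj.2 ⟨h'.1, h'.2⟩ }
    exact ⟨u, w, hu, hw, h.map f⟩
  · rintro ⟨u, w, hu, hw, ⟨p⟩⟩
    have hu' : u ∈ ballSet G o r := le_trans (b := (k : ℕ∞)) hu (by exact_mod_cast hkr)
    obtain ⟨v, hv, h⟩ := exists_reachable_ballGraph p hw hu'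
    exact ⟨⟨u, hu'⟩, v, by rwa [edist_ballGraph], by rwa [edist_ballGraph], h⟩

theorem preimage_armEvent_iso {V W : Type*} {G : SimpleGraph V} {H : SimpleGraph W} (e : G ≃g H)
    (o : V) (k r : ℕ) :
    (fun ω ↦ Sym2.map e ⁻¹' ω) ⁻¹' armEvent G o k r = armEvent H (e o) k r := by
  ext ω
  let f : openGraph G (Sym2.map e ⁻¹' ω) ≃g openGraph H ω :=
    { toEquiv := e.toEquiv
      map_rel_iff' := by
        intro a b
        rw [openGraph_adj, openGraph_adj]
        exact and_congr e.map_rel_iff Iff.rfl }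
  constructor
  · rintro ⟨u, w, hu, hw, h⟩
    exact ⟨e u, e w, by rwa [edist_iso], by rwa [edist_iso], f.reachable_iff.2 h⟩
  · rintro ⟨u, w, hu, hw, h⟩
    obtain ⟨u, rfl⟩ := e.surjective u
    obtain ⟨w, rfl⟩ := e.surjective w
    rw [edist_iso] at hu hw
    exact ⟨u, w, hu, hw, f.reachable_iff.1 h⟩

/-! ### Percolation as a limit of arm events -/

section probability
open ProbabilityTheory unitInterval

theorem measurableSet_armEvent {V : Type*} {G : SimpleGraph V} {o : V} {k r : ℕ} (hkr : k ≤ r)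
    (hfin : (ballSet G o r).Finite) : MeasurableSet (armEvent G o k r) := by
  have := hfin.to_subtype
  rw [← preimage_armEvent_ballGraph G o hkr]
  exact measurable_preimage _ (MeasurableSet.of_discrete)

theorem setBernoulli_armEvent_ballGraph {V : Type*} {G : SimpleGraph V} {o : V} {k r : ℕ}
    (hkr : k ≤ r) (hfin : (ballSet G o r).Finite) (p : I) :
    setBernoulli G.edgeSet p (armEvent G o k r) =
      setBernoulli (ballGraph G o r).edgeSet p
        (armEvent (ballGraph G o r) (ballRoot G o r) k r) := by
  have := hfin.to_subtype
  have h : (ballGraph G o r).edgeSet = Sym2.map Subtype.val ⁻¹' G.edgeSet := by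
    ext x
    induction x using Sym2.ind with
    | h a b => rfl
  rw [h, ← setBernoulli_map_preimage (sym2Map_val_injective _),
    Measure.map_apply (measurable_preimage _) MeasurableSet.of_discrete,
    preimage_armEvent_ballGraph G o hkr]

theorem setBernoulli_armEvent_iso {V W : Type*} [Finite V] {G : SimpleGraph V}
    {H : SimpleGraph W} (e : G ≃g H) (o : V) (k r : ℕ) (p : I) :
    setBernoulli G.edgeSet p (armEvent G o k r) =
      setBernoulli H.edgeSet p (armEvent H (e o) k r) := by
  have h : G.edgeSet = Sym2.map e ⁻¹' H.edgeSet := by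
    ext x
    induction x using Sym2.ind with
    | h a b => exact e.map_rel_iff.symm
  rw [h, ← setBernoulli_map_preimage (Sym2.map.injective e.injective),
    Measure.map_apply (measurable_preimage _) MeasurableSet.of_discrete,
    preimage_armEvent_iso]

theorem BallIso.setBernoulli_armEvent {V W : Type*} {G : SimpleGraph V} {o : V}
    {H : SimpleGraph W} {o' : W} {k r : ℕ} (h : BallIso G o H o' r) (hkr : k ≤ r)
    (hG : (ballSet G o r).Finite) (hH : (ballSet H o' r).Finite) (p : I) :
    setBernoulli G.edgeSet p (armEvent G o k r) =
      setBernoulli H.edgeSet p (armEvent H o' k r) := by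
  have := hG.to_subtype
  obtain ⟨e, he⟩ := h
  rw [setBernoulli_armEvent_ballGraph hkr hG, setBernoulli_armEvent_ballGraph hkr hH,
    setBernoulli_armEvent_iso e, he]

/-- An infinite cluster meets some ball around `o` and, balls being finite, leaves every ball.
Conversely, if all clusters were finite, those meeting the `k`-ball would have a bounded union, so
long arms could not exist. Writing the outer radius as `k + m` keeps it at least `k`. -/
theorem percolates_eq_iUnion_iInter {V : Type*} {G : SimpleGraph V} (hconn : G.Connected)
    (hfin : ∀ v r, (ballSet G v r).Finite) (o : V) :
    percolates G = ⋃ k, ⋂ m, armEvent G o k (k + m) := by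
  ext ω
  simp only [Set.mem_iUnion, Set.mem_iInter]
  constructor
  · rintro ⟨C, hC⟩
    obtain ⟨u, hu⟩ := hC.nonempty
    refine ⟨G.dist o u, fun m ↦ ?_⟩
    obtain ⟨w, hw, hwB⟩ := hC.exists_notMem_finite (hfin o (G.dist o u + m))
    refine ⟨u, w, ((hconn o u).coe_dist_eq_edist).ge, (not_le.1 hwB).le, ?_⟩
    exact SimpleGraph.ConnectedComponent.exact (hu.trans hw.symm)
  · rintro ⟨k, hk⟩
    by_contra hperc
    have hcomp (u : V) : {w | (openGraph G ω).Reachable u w}.Finite := by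
      by_contra hinf
      refine hperc ⟨(openGraph G ω).connectedComponentMk u, Set.Infinite.mono ?_ hinf⟩
      intro w hw
      exact SimpleGraph.ConnectedComponent.sound (SimpleGraph.Reachable.symm hw)
    have hF : (⋃ u ∈ ballSet G o k, {w | (openGraph G ω).Reachable u w}).Finite :=
      (hfin o k).biUnion fun u _ ↦ hcomp u
    obtain ⟨M, hM⟩ := (hF.image (G.dist o)).bddAbove
    obtain ⟨u, w, hu, hw, h⟩ := hk (M + 1)
    have hwM : G.dist o w ≤ M := hM ⟨w, Set.mem_biUnion (show u ∈ ballSet G o k from hu) h, rfl⟩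
    rw [← (hconn o w).coe_dist_eq_edist] at hw
    have hw' : k + (M + 1) ≤ G.dist o w := by exact_mod_cast hw
    omega

theorem measurableSet_percolates {V : Type*} {G : SimpleGraph V} (hconn : G.Connected)
    (hfin : ∀ v r, (ballSet G v r).Finite) : MeasurableSet (percolates G) := by
  obtain ⟨o⟩ := hconn.nonempty
  rw [percolates_eq_iUnion_iInter hconn hfin o]
  exact .iUnion fun k ↦ .iInter fun m ↦ measurableSet_armEvent (Nat.le_add_right k m) (hfin _ _)

theorem setBernoulli_percolates {V : Type*} {G : SimpleGraph V} (hconn : G.Connected)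
    (hfin : ∀ v r, (ballSet G v r).Finite) (o : V) (p : I) :
    setBernoulli G.edgeSet p (percolates G) =
      ⨆ k, ⨅ m, setBernoulli G.edgeSet p (armEvent G o k (k + m)) := by
  have hmono : Monotone fun k ↦ ⋂ m, armEvent G o k (k + m) := by
    refine fun k l hkl ↦ Set.subset_iInter fun m ↦ ?_
    -- The shift of `m` by `l - k` equalises the outer radii, so that only the inner radius grows.
    refine (Set.iInter_subset _ (l - k + m)).trans ?_
    have : k + (l - k + m) = l + m := by omega
    rw [this]
    exact armEvent_mono G o hkl _
  rw [percolates_eq_iUnion_iInter hconn hfin o, hmono.measure_iUnion]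
  refine iSup_congr fun k ↦ Antitone.measure_iInter ?_ ?_ ?_
  · exact fun m n hmn ↦ armEvent_antitone G o k (Nat.add_le_add_left hmn k)
  · exact fun m ↦ (measurableSet_armEvent (Nat.le_add_right k m) (hfin _ _)).nullMeasurableSet
  · exact ⟨0, measure_ne_top _ _⟩

/-! ### Percolation probabilities on the space of rooted graphs -/

namespace RootedGraphSpace
variable {Δ : ℕ}

/-- The probability of an open path from the ball of radius `k` around the root to distance
`k + m`. -/
noncomputable def armProb (p : I) (k m : ℕ) (x : RootedGraphSpace Δ) : ℝ≥0∞ :=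
  Quotient.liftOn x
    (fun X ↦ setBernoulli X.graph.edgeSet p (armEvent X.graph X.root k (k + m)))
    fun X Y h ↦ (RootedIso.ballIso h (k + m)).setBernoulli_armEvent (Nat.le_add_right k m)
      (finite_ballSet X.degree_le _ _) (finite_ballSet Y.degree_le _ _) p

/-- The value depends only on the ball of radius `k + m`, so the preimage of any set is a local
event. -/
theorem measurable_armProb (p : I) (k m : ℕ) :
    Measurable (armProb p k m : RootedGraphSpace Δ → ℝ≥0∞) := by
  intro S _
  refine IsLocal.measurableSet (r := k + m) fun x y hxy hx ↦ ?_
  induction x, y using Quotient.inductionOn₂ with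
  | h X Y =>
    have h := (ballSetoid_toSpace.1 hxy).setBernoulli_armEvent (Nat.le_add_right k m)
      (finite_ballSet X.degree_le _ _) (finite_ballSet Y.degree_le _ _) p
    change setBernoulli Y.graph.edgeSet p (armEvent Y.graph Y.root k (k + m)) ∈ S
    rw [← h]
    exact hx

/-- The probability that there is an infinite open component. -/
noncomputable def percolationProb (p : I) (x : RootedGraphSpace Δ) : ℝ≥0∞ :=
  ⨆ k, ⨅ m, armProb p k m x

theorem measurable_percolationProb (p : I) :
    Measurable (percolationProb p : RootedGraphSpace Δ → ℝ≥0∞) :=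
  .iSup fun k ↦ .iInf fun m ↦ measurable_armProb p k m

theorem percolationProb_toSpace (p : I) (X : RootedGraph Δ) :
    percolationProb p X.toSpace = setBernoulli X.graph.edgeSet p (percolates X.graph) :=
  (setBernoulli_percolates X.connected (finite_ballSet X.degree_le) X.root p).symm

theorem percolationProb_mono (x : RootedGraphSpace Δ) : Monotone fun p ↦ percolationProb p x := by
  intro p q hpq
  induction x using Quotient.inductionOn with
  | h X =>
    change percolationProb p X.toSpace ≤ percolationProb q X.toSpace
    rw [percolationProb_toSpace, percolationProb_toSpace]
    exact setBernoulli_mono _ hpq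
      (measurableSet_percolates X.connected (finite_ballSet X.degree_le))
      (isUpperSet_percolates _)

theorem criticalProb_eq_sInf (x : RootedGraphSpace Δ) :
    x.criticalProb = (sInf {p : I | 0 < percolationProb p x} : I) := by
  induction x using Quotient.inductionOn with
  | h X =>
    change _root_.criticalProb X.graph = (sInf {p : I | 0 < percolationProb p X.toSpace} : I)
    simp only [percolationProb_toSpace]
    rfl

/-- If `y` percolates at `p` and `t > p`, some `q ∈ D` lies strictly between; `y` percolates at `q`
by monotonicity, hence so does `x`. -/
theorem criticalProb_le_of_dense {D : Set I} (hD : Dense D) {x y : RootedGraphSpace Δ}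
    (h : ∀ p ∈ D, percolationProb p x = percolationProb p y) :
    x.criticalProb ≤ y.criticalProb := by
  rw [criticalProb_eq_sInf, criticalProb_eq_sInf, Subtype.coe_le_coe]
  refine le_sInf fun p hp ↦ le_of_forall_gt_imp_ge_of_dense fun t ht ↦ ?_
  obtain ⟨q, hq, hpq, hqt⟩ := hD.exists_between ht
  refine (sInf_le ?_).trans hqt.le
  change 0 < percolationProb q x
  rw [h q hq]
  exact lt_of_lt_of_le hp (percolationProb_mono y hpq.le)

theorem criticalProb_eq_of_dense {D : Set I} (hD : Dense D) {x y : RootedGraphSpace Δ}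
    (h : ∀ p ∈ D, percolationProb p x = percolationProb p y) :
    x.criticalProb = y.criticalProb :=
  le_antisymm (criticalProb_le_of_dense hD h)
    (criticalProb_le_of_dense hD fun p hp ↦ (h p hp).symm)

theorem rootInvariant_percolationProb (p : I) :
    RootInvariant fun x : RootedGraphSpace Δ ↦ (percolationProb p x).toReal := by
  intro X v w
  beta_reduce
  rw [percolationProb_toSpace, percolationProb_toSpace]
  rfl

theorem percolationProb_ne_top (p : I) (x : RootedGraphSpace Δ) : percolationProb p x ≠ ∞ := by
  induction x using Quotient.inductionOn with
  | h X =>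
    change percolationProb p X.toSpace ≠ ∞
    rw [percolationProb_toSpace]
    exact measure_ne_top _ _

end RootedGraphSpace

end probability

theorem theorem1 (c : ℝ) (hc : 0 < c) (Δ : ℕ) (V : ℕ → Type*) [∀ n, Fintype (V n)]
    [∀ n, Nonempty (V n)] (G : ∀ n, SimpleGraph (V n))
    (hcheeger : ∀ n, ENNReal.ofReal c ≤ cheegerConstant (G n))
    (hdeg : ∀ n v, ((G n).neighborSet v).encard ≤ Δ)
    (μ : Measure (RootedGraphSpace Δ)) [IsProbabilityMeasure μ]
    (hinf : ∀ᵐ x ∂μ, x.IsInfinite)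
    (hconv : ConvergesLocallyWeakly G μ) :
    (∃ p₀ : ℝ, ∀ᵐ x ∂μ, x.criticalProb = p₀) ∧
      ∀ f : RootedGraphSpace Δ → ℝ, Measurable f → RootedGraphSpace.RootInvariant f →
        ∃ a : ℝ, ∀ᵐ x ∂μ, f x = a := by
  have main (f : RootedGraphSpace Δ → ℝ) (hf : Measurable f)
      (hinv : RootedGraphSpace.RootInvariant f) : ∃ a : ℝ, ∀ᵐ x ∂μ, f x = a :=
    RootedGraphSpace.exists_ae_eq_const hc hcheeger hdeg hconv hf hinv
  refine ⟨?_, main⟩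
  -- Countability of `D` puts the almost sure constancy at all its parameters on one event, and
  -- density recovers `p_c`; measurability of `p_c` itself is never needed.
  obtain ⟨D, hDc, hD⟩ := TopologicalSpace.exists_countable_dense unitInterval
  choose a ha using fun p ↦ main _ (RootedGraphSpace.measurable_percolationProb p).ennreal_toReal
    (RootedGraphSpace.rootInvariant_percolationProb p)
  have hae : ∀ᵐ x ∂μ, ∀ p ∈ D, (RootedGraphSpace.percolationProb p x).toReal = a p :=
    (ae_ball_iff hDc).2 fun p _ ↦ ha p
  -- Any one point of the full-measure event serves as reference, its `p_c` being the constant.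
  obtain ⟨y, hy⟩ := hae.exists
  refine ⟨y.criticalProb, hae.mono fun x hx ↦ ?_⟩
  refine RootedGraphSpace.criticalProb_eq_of_dense hD fun p hp ↦ ?_
  rw [← ENNReal.toReal_eq_toReal_iff' (RootedGraphSpace.percolationProb_ne_top p x)
    (RootedGraphSpace.percolationProb_ne_top p y), hx p hp, hy p hp]
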